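/- **Theorem.** Fix a polynomial bound $A n^{a}$ on edge weights and identifiers. Let $G=(V,E,w)$ range over connected weighted undirected simple graphs on $n$ nodes, with integer edge weights $1\le w(e)\le A n^{a}$, with distinct node identifiers in $\{0,\dots,A n^{a}\}$, and with unweighted (hop) diameter $D$. In the $\mathsf{CONGEST}$ model, the nodes communicate over $G$ in synchronous rounds. In each round every node may send one $O(\log n)$-bit message to each of its neighbours, a possibly different one to each. Local computation is free, and each node has a private source of randomness, independent of the others. Initially a node knows $n$, the parameters of the algorithm, its own identifier, the identifiers of its neighbours, and the weights of its incident edges. For every real $k^*\ge 1$ there is a randomized $\mathsf{CONGEST}$ algorithm, taking a real parameter $\alpha$, with the following property. Let $1\le\alpha\le n/\ln n$, and let $G$ have a cycle $C^*$ that has minimum weight $w^*=w(C^*)$ among all cycles of $G$ and that has at most $10\,n\ln n/\alpha$ edges. Then the algorithm always terminates on $G$ within $$\tilde O\!\left(n^{1/k^*}+\frac n\alpha+D\right)$$ rounds, and with probability at least $1-o(1)$ all nodes output the same number $\tilde w$, where $$w^*\le\tilde w\le(k^*+1)\,w^* .$$ Here $\tilde O$ hides a factor $C(\ln n)^{c}$,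 and $o(1)$ tends to $0$ as $n\to\infty$. The constants $C$ and $c$, the constant in the message size and the $o(1)$ term depend only on $A$ and $a$; they do not depend on $G$, $\alpha$ or $k^*$. -/

import Mathlib

/-- A connected network on `n` nodes: an undirected simple graph with positive integer edge weights
(values of `weight` off the edges are irrelevant) and pairwise distinct node identifiers. -/
structure Network (n : ℕ) where
  graph : SimpleGraph (Fin n)
  weight : Sym2 (Fin n) → ℕ
  ident : Fin n → ℕ
  connected : graph.Connected
  one_le_weight : ∀ e ∈ graph.edgeSet, 1 ≤ weight e
  ident_injective : Function.Injective ident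

namespace Network

variable {n : ℕ}

/-- All edge weights and all identifiers are at most `A * n ^ a`. -/
def PolyBounded (N : Network n) (A a : ℕ) : Prop :=
  (∀ e ∈ N.graph.edgeSet, N.weight e ≤ A * n ^ a) ∧ ∀ v, N.ident v ≤ A * n ^ a

/-- What `v` knows about its surroundings at the start: for each incident edge, the identifier of the
other endpoint together with the weight of the edge. -/
def links (N : Network n) (v : Fin n) : Set (ℕ × ℕ) :=
  {p | ∃ u, N.graph.Adj v u ∧ N.ident u = p.1 ∧ N.weight s(v, u) = p.2}

/-- The weight of a cycle: the sum of the weights of its edges. (Its number of hops is its length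
as a walk.) -/
def cycleWeight (N : Network n) {v : Fin n} (p : N.graph.Walk v v) : ℕ :=
  (p.edges.map N.weight).sum

/-- `p` is a cycle of minimum weight among all cycles of the graph. -/
def IsMinWeightCycle (N : Network n) {v : Fin n} (p : N.graph.Walk v v) : Prop :=
  p.IsCycle ∧ ∀ (u : Fin n) (q : N.graph.Walk u u), q.IsCycle → N.cycleWeight p ≤ N.cycleWeight q

end Network

/-- A randomized algorithm for synchronous message passing with bandwidth `b`: in each round, a node
may send to each neighbour (addressed by its identifier) one message of `b` bits, possibly different
for different neighbours. Local computation is unrestricted, and every node runs the same code.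

* Every node has its own private random seed; the seeds of different nodes are independent and
  have law `seedLaw`. (On a standard Borel space this is the same as giving every node an infinite
  private tape of fair coin flips.)
* `init i L s` is the initial state of a node with identifier `i`, incident links `L` and seed `s`.
* `send x j` is the message, if any, for the neighbour with identifier `j`.
* `receive x M` is the new state after receiving the messages `M` (pairs of the identifier of the
  sender and the message).
* A node has halted once its state has an output. -/
structure CongestAlgorithm (b : ℕ) where
  Seed : Type
  [seedMeasurableSpace : MeasurableSpace Seed]
  [seedStandardBorel : StandardBorelSpace Seed]
  seedLaw : MeasureTheory.Measure Seed
  [seedLawProb : MeasureTheory.IsProbabilityMeasure seedLaw]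
  State : Type
  init : ℕ → Set (ℕ × ℕ) → Seed → State
  send : State → ℕ → Option (Fin b → Bool)
  receive : State → Set (ℕ × (Fin b → Bool)) → State
  output : State → Option ℝ

attribute [instance] CongestAlgorithm.seedMeasurableSpace CongestAlgorithm.seedStandardBorel
  CongestAlgorithm.seedLawProb

namespace CongestAlgorithm

variable {b n : ℕ}

/-- The messages that `v` receives when the current states of the nodes are `σ`: they come only from
neighbours that have not halted. -/
def inbox (P : CongestAlgorithm b) (N : Network n) (σ : Fin n → P.State) (v : Fin n) :
    Set (ℕ × (Fin b → Bool)) :=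
  {p | ∃ u, N.graph.Adj u v ∧ P.output (σ u) = none ∧ N.ident u = p.1 ∧
    P.send (σ u) (N.ident v) = some p.2}

/-- The states of the nodes after `t` rounds, for the private seeds `ω`. A node that has halted
keeps its state, hence its output, for ever. -/
def config (P : CongestAlgorithm b) (N : Network n) (ω : Fin n → P.Seed) : ℕ → Fin n → P.State
  | 0 => fun v => P.init (N.ident v) (N.links v) (ω v)
  | t + 1 => fun v =>
      if (P.output (config P N ω t v)).isSome then config P N ω t v
      else P.receive (config P N ω t v) (P.inbox N (config P N ω t) v)

/-- Every node halts within `R` rounds, whatever the random seeds are. -/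
def HaltsWithin (P : CongestAlgorithm b) (N : Network n) (R : ℕ) : Prop :=
  ∀ (ω : Fin n → P.Seed) (v : Fin n), (P.output (P.config N ω R v)).isSome

/-- With seeds `ω`, after `R` rounds all nodes have halted with the same output `x`. -/
def Outputs (P : CongestAlgorithm b) (N : Network n) (ω : Fin n → P.Seed) (R : ℕ) (x : ℝ) : Prop :=
  ∀ v : Fin n, P.output (P.config N ω R v) = some x

/-- The joint law of the independent private seeds of the `n` nodes. -/
noncomputable def law (P : CongestAlgorithm b) (n : ℕ) : MeasureTheory.Measure (Fin n → P.Seed) :=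
  MeasureTheory.Measure.pi fun _ => P.seedLaw

end CongestAlgorithm

/-! Take a cycle `C` of weight `w`, a vertex `x`, and the vertex `z` of `C` farthest from `x`. A
neighbour `u` of `z` on `C`, other than the parent of `z` on a cheapest walk from `x`, closes a
cycle of cost at most d(x,z) + w(z,u) + d(x,u), which is at most 2 d(x,y) + w for every `y` on `C`
(`exists_farthest`, `exists_isCycle_of_costDist`). So it is enough that all of `C` learns its
distances to one source `x` near `C`.

Such a source comes from nested random levels: level 0 contains every node, and each level is
reached from the previous one with probability `p`, slightly below n^(-1/K). Start at level 0 with a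
vertex of `C`. If the current source of level `i` is among the first `t` sources of its level at
every node of `C`, it is detected. Otherwise, at some node of `C`, at least `t` sources of level `i`
are nearer (ties by identifier). With high probability one of them lies in level `i + 1`, and
passing to it adds at most w/2 to the distance from `C`. Level `K` is probably empty, so the descent
stops at some `i < K` with 2 d ≤ i w, and the recognized cycle costs at most (i+1) w ≤ K w
(`exists_level`, `exists_cycleEstimate_le`, `pi_missesPrefix_le`).

Detection is pipelined: a node announces a source in the round that is the sum of its distance and
of its position in the local order, so the time is about distance plus `t` (`isDue_iff`). To keep
distances small, weights are rounded up to multiples of a unit chosen for each power of two. On a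
cycle with few hops this costs a factor 1 + 2ε, and `K` is chosen with K(1+2ε) ≤ k + 1
(`levelCount_mul_le`).

Finally the minimum estimate is flooded. As the diameter is unknown, the radius doubles until a test
of agreement succeeds, at the same time for all nodes (`flood_agreeBit_eq_zero`,
`outputs_algorithm`). Every candidate bounds the weight of a real cycle, so the lower bound and the
running time hold for all seeds; only the upper bound is probabilistic. -/

namespace SimpleGraph

/-! ### Cheapest walks and the cycles they close. -/

variable {V : Type*} {G : SimpleGraph V}

/-- The sum of the costs of the edges of a walk. -/
def Walk.cost (w : Sym2 V → ℕ) {u v : V} (p : G.Walk u v) : ℕ := (p.edges.map w).sum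

namespace Walk

variable (w : Sym2 V → ℕ)

@[simp] theorem cost_nil (u : V) : (nil : G.Walk u u).cost w = 0 := by simp [cost]

@[simp] theorem cost_cons {u v x : V} (h : G.Adj u v) (p : G.Walk v x) :
    (cons h p).cost w = w s(u, v) + p.cost w := by simp [cost]

@[simp] theorem cost_append {u v x : V} (p : G.Walk u v) (q : G.Walk v x) :
    (p.append q).cost w = p.cost w + q.cost w := by simp [cost, edges_append]

@[simp] theorem cost_reverse {u v : V} (p : G.Walk u v) : p.reverse.cost w = p.cost w := by
  simp [cost, edges_reverse, List.sum_reverse]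

theorem cost_bypass_le [DecidableEq V] {u v : V} (p : G.Walk u v) :
    p.bypass.cost w ≤ p.cost w := by
  induction p with
  | nil => simp [bypass]
  | cons h p ih =>
    rw [bypass]
    split_ifs with hs
    · have h1 := congrArg (cost w) (p.bypass.take_spec hs)
      rw [cost_append] at h1
      rw [cost_cons]
      omega
    · simpa using ih

theorem cost_rotate [DecidableEq V] {u v : V} (c : G.Walk v v) (h : u ∈ c.support) :
    (c.rotate u h).cost w = c.cost w := by
  have h1 := congrArg (cost w) (c.take_spec h)
  rw [cost_append] at h1
  rw [rotate, cost_append]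
  omega

end Walk

/-- The smallest cost of a walk from `x` to `v`. -/
noncomputable def costDist (G : SimpleGraph V) (w : Sym2 V → ℕ) (x v : V) : ℕ :=
  sInf {m | ∃ p : G.Walk x v, p.cost w = m}

variable (w : Sym2 V → ℕ)

theorem costDist_le {x v : V} (p : G.Walk x v) : G.costDist w x v ≤ p.cost w :=
  Nat.sInf_le ⟨p, rfl⟩

@[simp] theorem costDist_self (x : V) : G.costDist w x x = 0 :=
  Nat.le_zero.mp (by simpa using costDist_le w (Walk.nil : G.Walk x x))

theorem Connected.exists_cost_eq_costDist (hG : G.Connected) (x v : V) :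
    ∃ p : G.Walk x v, p.cost w = G.costDist w x v := by
  obtain ⟨p⟩ := hG.preconnected x v
  exact Nat.sInf_mem (s := {m | ∃ p : G.Walk x v, p.cost w = m}) ⟨_, p, rfl⟩

theorem Connected.costDist_le_add_cost (hG : G.Connected) (x : V) {u v : V} (q : G.Walk u v) :
    G.costDist w x v ≤ G.costDist w x u + q.cost w := by
  obtain ⟨p, hp⟩ := hG.exists_cost_eq_costDist w x u
  simpa [hp] using costDist_le w (p.append q)

theorem Connected.costDist_le_of_adj (hG : G.Connected) (x : V) {u v : V} (h : G.Adj u v) :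
    G.costDist w x v ≤ G.costDist w x u + w s(u, v) := by
  simpa using hG.costDist_le_add_cost w x (Walk.cons h Walk.nil)

theorem Connected.exists_costDist_eq_add (hG : G.Connected) {x v : V} (hne : x ≠ v) :
    ∃ u, G.Adj u v ∧ G.costDist w x v = G.costDist w x u + w s(u, v) := by
  obtain ⟨p, hp⟩ := hG.exists_cost_eq_costDist w x v
  obtain ⟨q, hq⟩ : ∃ q : G.Walk v x, q.cost w = G.costDist w x v := ⟨p.reverse, by simpa using hp⟩
  cases q with
  | nil => exact absurd rfl hne
  | @cons _ u _ h q =>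
    refine ⟨u, h.symm, le_antisymm (hG.costDist_le_of_adj w x h.symm) ?_⟩
    have := costDist_le w q.reverse
    rw [Walk.cost_reverse] at this
    rw [Walk.cost_cons, Sym2.eq_swap] at hq
    omega

/-- The part of the walk before the dart already costs at least the distance to the tail of the
dart. -/
theorem Connected.costDist_add_le_of_mem_darts (hG : G.Connected) {x v : V} (p : G.Walk x v)
    {d : G.Dart} (hd : d ∈ p.darts) : G.costDist w x d.fst + w d.edge ≤ p.cost w := by
  induction p with
  | nil => simp at hd
  | @cons a b c h p ih =>
    rw [Walk.darts_cons, List.mem_cons] at hd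
    rcases hd with rfl | hd
    · simp [Dart.edge]
    · obtain ⟨q, hq⟩ := hG.exists_cost_eq_costDist w b d.fst
      have h1 := costDist_le w (Walk.cons h q)
      have h2 := ih hd
      rw [Walk.cost_cons] at h1 ⊢
      omega

/-- An edge lies on no cheapest walk to a vertex `y` unless it ends a cheapest walk to one of its
ends, which is then no farther than `y`. -/
theorem Connected.edge_notMem_edges (hG : G.Connected) {x y a b : V} (p : G.Walk x y)
    (hab : G.costDist w x y < G.costDist w x a + w s(a, b))
    (hba : G.costDist w x y < G.costDist w x b + w s(a, b))
    (hp : p.cost w = G.costDist w x y) : s(a, b) ∉ p.edges := by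
  intro h
  rw [Walk.edges, List.mem_map] at h
  obtain ⟨d, hd, hde⟩ := h
  have h1 := hG.costDist_add_le_of_mem_darts w p hd
  rw [hde] at h1
  rcases d with ⟨⟨c, e⟩, hce⟩
  rcases Sym2.eq_iff.mp hde with ⟨h2, -⟩ | ⟨h2, -⟩ <;> simp only at h1 h2 <;> subst h2 <;> omega

/-- A walk between the ends of an edge that avoids the edge closes up to a cycle. -/
theorem exists_isCycle_of_walk [DecidableEq V] {a b : V} (hab : G.Adj a b) (p : G.Walk b a)
    (hp : s(a, b) ∉ p.edges) :
    ∃ q : G.Walk a a, q.IsCycle ∧ q.cost w ≤ w s(a, b) + p.cost w :=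
  ⟨Walk.cons hab p.bypass, (Walk.cons_isCycle_iff _ _).mpr
    ⟨p.bypass_isPath, fun h => hp (p.edges_bypass_subset_edges h)⟩, by
      rw [Walk.cost_cons]; exact Nat.add_le_add_left (p.cost_bypass_le w) _⟩

/-- If the edge `z u` does not end the chosen cheapest walk from `x` to either of its ends, then
there is a cycle through it that costs at most as much as the closed walk through `x`. -/
theorem Connected.exists_isCycle_of_costDist (hG : G.Connected)
    (hw : ∀ e ∈ G.edgeSet, 1 ≤ w e) {x z u : V} (hzu : G.Adj z u)
    (hu : G.costDist w x u < G.costDist w x z + w s(z, u))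
    (hz : z = x ∨ ∃ u', u' ≠ u ∧ G.Adj z u' ∧
      G.costDist w x u' + w s(z, u') = G.costDist w x z) :
    ∃ q : G.Walk z z, q.IsCycle ∧
      q.cost w ≤ G.costDist w x z + w s(z, u) + G.costDist w x u := by
  classical
  have h1 := hw s(z, u) hzu
  obtain ⟨p, hp⟩ := hG.exists_cost_eq_costDist w x u
  have hpe : s(z, u) ∉ p.edges := hG.edge_notMem_edges w p hu (by omega) hp
  obtain ⟨r, hr, hre⟩ : ∃ r : G.Walk x z, r.cost w = G.costDist w x z ∧ s(z, u) ∉ r.edges := by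
    rcases hz with rfl | ⟨u', hne, hadj, heq⟩
    · exact ⟨Walk.nil, by simp, by simp⟩
    -- A cheapest walk to `z` through `u'` avoids the edge `z u`: its last edge is a different one,
    -- and its part up to `u'` is too cheap to contain `z u`, as d(x,u') < d(x,z) ≤ d(x,u) + w(z,u).
    · obtain ⟨r, hr⟩ := hG.exists_cost_eq_costDist w x u'
      have h2 := hw s(z, u') hadj
      have h3 := hG.costDist_le_of_adj w x hzu.symm
      rw [Sym2.eq_swap] at h3
      refine ⟨r.concat hadj.symm, ?_, ?_⟩
      · rw [Walk.concat_eq_append, Walk.cost_append, hr, ← heq]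
        simp [Sym2.eq_swap]
      · rw [Walk.edges_concat, List.concat_eq_append, List.mem_append, not_or]
        refine ⟨hG.edge_notMem_edges w r (by omega) (by omega) hr, ?_⟩
        rw [List.mem_singleton, Sym2.eq_iff]
        rintro (⟨h4, -⟩ | ⟨-, h4⟩)
        · exact hadj.ne h4
        · exact hne h4.symm
  obtain ⟨q, hq, hqw⟩ := exists_isCycle_of_walk w hzu (p.reverse.append r) (by
    rw [Walk.edges_append, List.mem_append, Walk.edges_reverse, List.mem_reverse]; tauto)
  refine ⟨q, hq, hqw.trans ?_⟩
  rw [Walk.cost_append, Walk.cost_reverse, hp, hr]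
  omega

/-- Any two vertices of a closed walk are within half of its cost. -/
theorem two_mul_costDist_le_cost {a u v : V} (c : G.Walk a a) (hu : u ∈ c.support)
    (hv : v ∈ c.support) : 2 * G.costDist w u v ≤ c.cost w := by
  classical
  have hv' : v ∈ (c.rotate u hu).support := (Walk.mem_support_rotate_iff _ _ hu).mpr hv
  rw [← Walk.cost_rotate w c hu]
  have h := congrArg (Walk.cost w) ((c.rotate u hu).take_spec hv')
  rw [Walk.cost_append] at h
  have h1 := costDist_le w ((c.rotate u hu).takeUntil v hv')
  have h2 := costDist_le w ((c.rotate u hu).dropUntil v hv').reverse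
  rw [Walk.cost_reverse] at h2
  omega

theorem Connected.two_mul_costDist_le (hG : G.Connected) {a u v : V} (x : V) (c : G.Walk a a)
    (hu : u ∈ c.support) (hv : v ∈ c.support) :
    2 * G.costDist w x v ≤ 2 * G.costDist w x u + c.cost w := by
  obtain ⟨q, hq⟩ := hG.exists_cost_eq_costDist w u v
  have := hG.costDist_le_add_cost w x q
  have := two_mul_costDist_le_cost w c hu hv
  omega

/-- Without its first edge, the closed walk splits at `u` into one arc to `c.snd` and one to `z`.
Reaching both ends from `x` through `u` uses each arc once. -/
theorem Connected.costDist_snd_le (hG : G.Connected) {z u : V} (x : V) (c : G.Walk z z)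
    (hc : ¬ c.Nil) (hu : u ∈ c.support) :
    G.costDist w x z + w s(z, c.snd) + G.costDist w x c.snd ≤
      2 * G.costDist w x u + c.cost w := by
  classical
  cases c with
  | nil => simp at hc
  | @cons _ b _ h q =>
    have hu' : u ∈ q.support := by
      rw [Walk.support_cons, List.mem_cons] at hu
      rcases hu with rfl | hu
      · exact q.end_mem_support
      · exact hu
    have h1 := congrArg (Walk.cost w) (q.take_spec hu')
    rw [Walk.cost_append] at h1
    have h2 := hG.costDist_le_add_cost w x (q.dropUntil u hu')
    have h3 := hG.costDist_le_add_cost w x (q.takeUntil u hu').reverse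
    rw [Walk.cost_reverse] at h3
    simp only [Walk.snd_cons, Walk.cost_cons]
    omega

/-- The vertex `z` of a cycle that is farthest from `x` has a neighbour `u` on the cycle, avoiding
any given vertex, such that the closed walk through `x` and the edge `z u` is cheap. -/
theorem Connected.exists_farthest (hG : G.Connected) {a : V} (x : V) (c : G.Walk a a)
    (hc : c.IsCycle) :
    ∃ z ∈ c.support, ∀ p : V, ∃ u ∈ c.support, u ≠ p ∧ G.Adj z u ∧
      G.costDist w x u ≤ G.costDist w x z ∧
      ∀ y ∈ c.support, G.costDist w x z + w s(z, u) + G.costDist w x u ≤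
        2 * G.costDist w x y + c.cost w := by
  classical
  obtain ⟨z, hz, hmax⟩ := c.support.toFinset.exists_max_image (G.costDist w x)
    ⟨a, by simp⟩
  simp only [List.mem_toFinset] at hz hmax
  refine ⟨z, hz, fun p => ?_⟩
  set c' := c.rotate z hz with hc'
  have hcyc : c'.IsCycle := hc.rotate hz
  have hsupp : ∀ y, y ∈ c'.support ↔ y ∈ c.support := fun y => Walk.mem_support_rotate_iff _ _ hz
  have key : ∀ d : G.Walk z z, d.IsCycle → (∀ y, y ∈ d.support ↔ y ∈ c.support) →
      d.cost w = c.cost w → d.snd ≠ p → ∃ u ∈ c.support, u ≠ p ∧ G.Adj z u ∧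
      G.costDist w x u ≤ G.costDist w x z ∧
      ∀ y ∈ c.support, G.costDist w x z + w s(z, u) + G.costDist w x u ≤
        2 * G.costDist w x y + c.cost w := by
    intro d hd hds hdc hdp
    have hm : d.snd ∈ c.support := (hds _).mp (d.getVert_mem_support 1)
    refine ⟨d.snd, hm, hdp, d.adj_snd hd.not_nil, hmax _ hm, fun y hy => ?_⟩
    rw [← hdc]
    exact hG.costDist_snd_le w x d hd.not_nil ((hds y).mpr hy)
  -- The two neighbours of `z` on the cycle differ, and reversing the cycle exchanges them, so one
  -- of them is not `p`.
  by_cases hp : c'.snd = p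
  · refine key c'.reverse hcyc.reverse (fun y => by simp [hsupp]) ?_ ?_
    · rw [Walk.cost_reverse, hc', Walk.cost_rotate]
    · rw [Walk.snd_reverse, ← hp]
      exact hcyc.snd_ne_penultimate.symm
  · exact key c' hcyc hsupp (by rw [hc', Walk.cost_rotate]) hp

end SimpleGraph

/-! ### Pipelined source detection. -/

/-- The number of elements of `S` that precede `x` in the order by distance, ties broken by
identifier. -/
noncomputable def precedence {V : Type*} (S : Set V) (dist ident : V → ℕ) (x : V) : ℕ :=
  {y | y ∈ S ∧ toLex (dist y, ident y) < toLex (dist x, ident x)}.ncard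

/-- The pairs (distance, identifier) in `E` with the smallest distance for their identifier. -/
def bestEstimates (E : Set (ℕ × ℕ)) : Set (ℕ × ℕ) :=
  {p | p ∈ E ∧ ∀ p' ∈ E, p'.2 = p.2 → p.1 ≤ p'.1}

/-- The estimate that pipelining schedules for round `r`: the sum of its distance and of its position
is `r`. -/
def IsDue (E : Set (ℕ × ℕ)) (r : ℕ) (p : ℕ × ℕ) : Prop :=
  p ∈ bestEstimates E ∧ p.1 + {p' | p' ∈ bestEstimates E ∧ toLex p' < toLex p}.ncard = r

section

variable {V : Type*} {S : Set V} {dist ident : V → ℕ} {E : Set (ℕ × ℕ)} {r : ℕ}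

theorem le_of_toLex_le {a b c d : ℕ} (h : toLex (a, b) ≤ toLex (c, d)) : a ≤ c := by
  rw [Prod.Lex.toLex_le_toLex] at h
  rcases h with h | h
  · exact h.le
  · exact h.1.le

theorem mem_bestEstimates (hid : Function.Injective ident)
    (hE : ∀ p ∈ E, ∃ x ∈ S, ident x = p.2 ∧ dist x ≤ p.1)
    (hr : ∀ x ∈ S, dist x + precedence S dist ident x ≤ r → (dist x, ident x) ∈ E)
    {x : V} (hx : x ∈ S) (h : dist x + precedence S dist ident x ≤ r) :
    (dist x, ident x) ∈ bestEstimates E := by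
  refine ⟨hr x hx h, fun p' hp' he => ?_⟩
  obtain ⟨y, -, hy, hle⟩ := hE p' hp'
  obtain rfl : y = x := hid (hy.trans he)
  exact hle

variable [Finite V]

theorem precedence_lt {x y : V} (hy : y ∈ S)
    (h : toLex (dist y, ident y) < toLex (dist x, ident x)) :
    precedence S dist ident y < precedence S dist ident x :=
  Set.ncard_lt_ncard ⟨fun _ hz => ⟨hz.1, hz.2.trans h⟩, fun hs => lt_irrefl _ (hs ⟨hy, h⟩).2⟩
    (Set.toFinite _)

/-- Along the order, distances do not decrease and positions strictly increase. So no two sources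
are scheduled for the same round, and one message per round suffices. -/
theorem eq_of_dist_add_precedence_eq (hid : Function.Injective ident) {x y : V} (hx : x ∈ S)
    (hy : y ∈ S) (h : dist x + precedence S dist ident x = dist y + precedence S dist ident y) :
    x = y := by
  rcases lt_trichotomy (toLex (dist x, ident x)) (toLex (dist y, ident y)) with h1 | h1 | h1
  · have := precedence_lt hx h1
    have := le_of_toLex_le h1.le
    omega
  · exact hid (Prod.mk.inj (toLex.injective h1)).2
  · have := precedence_lt hy h1
    have := le_of_toLex_le h1.le
    omega

/-- Sources preceding `x` are scheduled earlier than `x`, so their exact pairs are known; hence the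
position computed from the estimates is the true one. -/
theorem ncard_bestEstimates_lt (hid : Function.Injective ident)
    (hE : ∀ p ∈ E, ∃ x ∈ S, ident x = p.2 ∧ dist x ≤ p.1)
    (hr : ∀ x ∈ S, dist x + precedence S dist ident x ≤ r → (dist x, ident x) ∈ E)
    {x : V} (h : dist x + precedence S dist ident x ≤ r) :
    {p' | p' ∈ bestEstimates E ∧ toLex p' < toLex (dist x, ident x)}.ncard =
      precedence S dist ident x := by
  rw [precedence, ← Set.InjOn.ncard_image (f := fun y => (dist y, ident y))
    (fun a _ b _ hab => hid (Prod.mk.inj hab).2)]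
  have hlt : ∀ y ∈ S, toLex (dist y, ident y) < toLex (dist x, ident x) →
      (dist y, ident y) ∈ bestEstimates E := fun y hy hyx => by
    have := precedence_lt hy hyx
    have := le_of_toLex_le hyx.le
    exact mem_bestEstimates hid hE hr hy (by omega)
  congr 1
  ext p
  constructor
  · rintro ⟨hp, hpx⟩
    obtain ⟨y, hy, hyp, hle⟩ := hE p hp.1
    have hyx : toLex (dist y, ident y) < toLex (dist x, ident x) := by
      exact lt_of_le_of_lt (Prod.Lex.toLex_mono ⟨hle, hyp.le⟩) hpx
    refine ⟨y, ⟨hy, hyx⟩, Prod.ext (le_antisymm hle ?_) hyp⟩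
    exact hp.2 _ (hlt y hy hyx).1 hyp
  · rintro ⟨y, ⟨hy, hyx⟩, rfl⟩
    exact ⟨hlt y hy hyx, hyx⟩

/-- Pipelining is exact: if the estimates are never too small, and are exact for all sources that are
scheduled up to round `r`, then the pair that is due in round `r` is the true one. -/
theorem isDue_iff (hid : Function.Injective ident)
    (hE : ∀ p ∈ E, ∃ x ∈ S, ident x = p.2 ∧ dist x ≤ p.1)
    (hr : ∀ x ∈ S, dist x + precedence S dist ident x ≤ r → (dist x, ident x) ∈ E) (p : ℕ × ℕ) :
    IsDue E r p ↔ ∃ x ∈ S, p = (dist x, ident x) ∧ dist x + precedence S dist ident x = r := by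
  constructor
  · rintro ⟨hp, hpr⟩
    obtain ⟨x, hx, hxp, hle⟩ := hE p hp.1
    by_cases h : dist x + precedence S dist ident x ≤ r
    · have hpx : p = (dist x, ident x) :=
        Prod.ext (le_antisymm (hp.2 _ (hr x hx h) hxp) hle) hxp.symm
      subst hpx
      rw [ncard_bestEstimates_lt hid hE hr h] at hpr
      exact ⟨x, hx, rfl, hpr⟩
    · exfalso
      -- Let `y` be the first source up to `x` that is scheduled after `r`. All sources before `y`
      -- are known exactly and precede `p`, so `p` has at least the distance and the position of `y`
      -- and cannot be due by round `r`.
      obtain ⟨y, ⟨hy, hyx, hyr⟩, hmin⟩ := (Set.toFinite {y | y ∈ S ∧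
        toLex (dist y, ident y) ≤ toLex (dist x, ident x) ∧
        r < dist y + precedence S dist ident y}).exists_minimalFor
          (fun y => toLex (dist y, ident y)) _ ⟨x, hx, le_rfl, not_le.mp h⟩
      have hyd := le_of_toLex_le hyx
      have hxp' : toLex (dist x, ident x) ≤ toLex p :=
        Prod.Lex.toLex_mono ⟨hle, hxp.le⟩
      have : precedence S dist ident y ≤
          {p' | p' ∈ bestEstimates E ∧ toLex p' < toLex p}.ncard := by
        rw [precedence, ← Set.InjOn.ncard_image (f := fun y => (dist y, ident y))
          (fun a _ b _ hab => hid (Prod.mk.inj hab).2)]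
        refine Set.ncard_le_ncard ?_ ?_
        · rintro _ ⟨z, ⟨hz, hzy⟩, rfl⟩
          refine ⟨mem_bestEstimates hid hE hr hz ?_, hzy.trans_le (hyx.trans hxp')⟩
          by_contra hc
          exact hzy.not_ge (hmin ⟨hz, hzy.le.trans hyx, not_le.mp hc⟩ hzy.le)
        · refine ((Set.finite_Iic p.1).prod (Set.finite_range ident)).subset ?_
          rintro ⟨d, i⟩ ⟨hp', hlt⟩
          obtain ⟨z, -, hz, -⟩ := hE _ hp'.1
          refine ⟨le_of_toLex_le (b := i) (d := p.2) ?_, z, hz⟩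
          rw [Prod.mk.eta]
          exact hlt.le
      omega
  · rintro ⟨x, hx, rfl, h⟩
    exact ⟨mem_bestEstimates hid hE hr hx h.le, by rwa [ncard_bestEstimates_lt hid hE hr h.le]⟩

end

/-- The estimates of a node: `0` for itself if it is a source, and the sums of a received distance
and of the rescaled weight of the edge it came through. -/
def estimates (me : ℕ) (L : Set (ℕ × ℕ)) (scale : ℕ → ℕ) (src : Prop) (heard : Set (ℕ × ℕ)) :
    Set (ℕ × ℕ) :=
  {p | (src ∧ p = (0, me)) ∨ ∃ j ω d i, (j, ω) ∈ L ∧ (j, Nat.pair d i) ∈ heard ∧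
    p = (d + scale ω, i)}

namespace Network

variable {n : ℕ} (N : Network n) (scale : ℕ → ℕ) (S : Set (Fin n))

/-- The distance with respect to rescaled weights. -/
noncomputable def scaledDist (x v : Fin n) : ℕ := N.graph.costDist (fun e => scale (N.weight e)) x v

/-- In round `r` of source detection, `v` announces the distance of the source `x`. -/
def Announces (v : Fin n) (r : ℕ) (x : Fin n) : Prop :=
  x ∈ S ∧ N.scaledDist scale x v +
    precedence S (fun x => N.scaledDist scale x v) N.ident x = r

theorem Announces.eq {N : Network n} {scale S} {v : Fin n} {r : ℕ} {x y : Fin n}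
    (hx : N.Announces scale S v r x) (hy : N.Announces scale S v r y) : x = y :=
  eq_of_dist_add_precedence_eq (dist := fun x => N.scaledDist scale x v) N.ident_injective hx.1 hy.1 (hx.2.trans hy.2.symm)

/-- The messages that `v` receives in round `q` of source detection. -/
def detectionInbox (v : Fin n) (q : ℕ) : Set (ℕ × ℕ) :=
  {p | ∃ u x, N.graph.Adj u v ∧ N.Announces scale S u q x ∧
    p = (N.ident u, Nat.pair (N.scaledDist scale x u) (N.ident x))}

variable {N scale S}

/-- If `u` is the parent of `v` towards `x`, then a source preceding `x` at `u` also precedes it at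
`v`: crossing the edge adds the full weight for `x` and at most that for any other source. -/
theorem precedence_le_of_scaledDist_eq {u v x : Fin n} (huv : N.graph.Adj u v)
    (hd : N.scaledDist scale x v = N.scaledDist scale x u + scale (N.weight s(u, v))) :
    precedence S (fun x => N.scaledDist scale x u) N.ident x ≤
      precedence S (fun x => N.scaledDist scale x v) N.ident x := by
  refine Set.ncard_le_ncard (fun y hy => ⟨hy.1, ?_⟩) (Set.toFinite _)
  have h2 : N.scaledDist scale y v ≤ N.scaledDist scale y u + scale (N.weight s(u, v)) :=
    N.connected.costDist_le_of_adj (fun e => scale (N.weight e)) y huv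
  have h3 := hy.2
  rw [Prod.Lex.toLex_lt_toLex] at h3 ⊢
  simp only at h3 ⊢
  omega

/-- The parent of `v` towards `x` has a distance smaller by at least 1 and no larger position, so it
announced `x` in a strictly earlier round and `v` has heard the exact value in time. -/
theorem isDue_estimates_iff (hs : ∀ ω, 1 ≤ ω → 1 ≤ scale ω) (v : Fin n) (r : ℕ) (p : ℕ × ℕ) :
    IsDue (estimates (N.ident v) (N.links v) scale (v ∈ S)
      {m | ∃ q < r, m ∈ N.detectionInbox scale S v q}) r p ↔
    ∃ x, N.Announces scale S v r x ∧ p = (N.scaledDist scale x v, N.ident x) := by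
  rw [isDue_iff (S := S) (dist := fun x => N.scaledDist scale x v) N.ident_injective]
  · simp only [Announces]
    exact ⟨fun ⟨x, h1, h2, h3⟩ => ⟨x, ⟨h1, h3⟩, h2⟩, fun ⟨x, ⟨h1, h3⟩, h2⟩ => ⟨x, h1, h2, h3⟩⟩
  · rintro p (⟨hv, rfl⟩ | ⟨j, ω, d, i, ⟨u, hvu, rfl, rfl⟩, ⟨q, -, u', x, hadj, hann, hp⟩, rfl⟩)
    · exact ⟨v, hv, rfl, by simp [scaledDist]⟩
    · obtain ⟨h1, h2⟩ := Prod.mk.inj hp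
      obtain rfl := N.ident_injective h1
      obtain ⟨rfl, rfl⟩ := Nat.pair_eq_pair.mp h2
      refine ⟨x, hann.1, rfl, ?_⟩
      have := N.connected.costDist_le_of_adj (fun e => scale (N.weight e)) x hadj
      rwa [Sym2.eq_swap] at this
  · intro x hx hxr
    by_cases hne : x = v
    · subst hne
      exact Or.inl ⟨hx, by simp [scaledDist]⟩
    · obtain ⟨u, huv, hd⟩ :=
        N.connected.exists_costDist_eq_add (fun e => scale (N.weight e)) hne
      have hd' : N.scaledDist scale x v = N.scaledDist scale x u + scale (N.weight s(u, v)) := hd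
      have h1 := hs _ (N.one_le_weight s(u, v) huv)
      refine Or.inr ⟨N.ident u, N.weight s(v, u), N.scaledDist scale x u, N.ident x,
        ⟨u, huv.symm, rfl, rfl⟩, ⟨_, ?_, u, x, huv, ⟨hx, rfl⟩, rfl⟩, ?_⟩
      · have := precedence_le_of_scaledDist_eq (S := S) huv hd'
        omega
      · rw [Sym2.eq_swap, hd']

end Network

/-! ### Flooding of minima and the test of agreement. -/

namespace SimpleGraph

variable {V : Type*} (G : SimpleGraph V)

/-- The smallest value of `f` within `q` hops, computed by `q` rounds of flooding. -/
noncomputable def flood (f : V → ℕ) : ℕ → V → ℕ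
  | 0, v => f v
  | q + 1, v => sInf (insert (flood f q v) {m | ∃ u, G.Adj u v ∧ flood f q u = m})

variable {G} {f : V → ℕ}

theorem flood_succ_le_self (q : ℕ) (v : V) : G.flood f (q + 1) v ≤ G.flood f q v :=
  Nat.sInf_le (Set.mem_insert _ _)

theorem flood_succ_le_of_adj (q : ℕ) {u v : V} (h : G.Adj u v) :
    G.flood f (q + 1) v ≤ G.flood f q u :=
  Nat.sInf_le (Set.mem_insert_of_mem _ ⟨u, h, rfl⟩)

theorem flood_le {q : ℕ} {v u : V} (p : G.Walk v u) (hp : p.length ≤ q) :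
    G.flood f q v ≤ f u := by
  induction q generalizing v with
  | zero =>
    cases p with
    | nil => rfl
    | cons h p => simp at hp
  | succ q ih =>
    cases p with
    | nil => exact (flood_succ_le_self q _).trans (ih Walk.nil (Nat.zero_le q))
    | cons h p =>
      exact (flood_succ_le_of_adj q h.symm).trans (ih p (by simpa using hp))

theorem exists_flood_eq (q : ℕ) (v : V) :
    ∃ (u : V) (p : G.Walk v u), p.length ≤ q ∧ G.flood f q v = f u := by
  induction q generalizing v with
  | zero => exact ⟨v, Walk.nil, by simp, rfl⟩
  | succ q ih =>
    rcases Nat.sInf_mem (s := insert (G.flood f q v) {m | ∃ u, G.Adj u v ∧ G.flood f q u = m})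
      ⟨_, Set.mem_insert _ _⟩ with h | ⟨y, hy, h⟩
    · obtain ⟨u, p, hp, hu⟩ := ih v
      exact ⟨u, p, by omega, h.trans hu⟩
    · obtain ⟨u, p, hp, hu⟩ := ih y
      exact ⟨u, Walk.cons hy.symm p, by simpa using hp, h.symm.trans hu⟩

variable (G f) in
/-- `0` if some neighbour has another minimum after `h` rounds of flooding, else `1`. -/
noncomputable def agreeBit (h : ℕ) (v : V) : ℕ :=
  open Classical in if ∃ u, G.Adj u v ∧ G.flood f h u ≠ G.flood f h v then 0 else 1

variable (G f) in
/-- All vertices have the same minimum after `h` rounds of flooding. -/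
def FloodAgrees (h : ℕ) : Prop := ∀ u v, G.flood f h u = G.flood f h v

theorem FloodAgrees.le {h : ℕ} (ha : G.FloodAgrees f h) (u v : V) : G.flood f h v ≤ f u :=
  (ha v u).trans_le (flood_le Walk.nil (by simp))

theorem FloodAgrees.flood_agreeBit_eq_one {h : ℕ} (ha : G.FloodAgrees f h) (q : ℕ) (v : V) :
    G.flood (G.agreeBit f h) q v = 1 := by
  obtain ⟨u, -, -, hu⟩ := exists_flood_eq (G := G) (f := G.agreeBit f h) q v
  rw [hu, agreeBit, if_neg]
  rintro ⟨y, -, hy⟩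
  exact hy (ha y u)

/-- As `f` is injective, all vertices that share the minimum of `v` lie within `h` hops of its
single origin `y`. A walk leaving this set crosses an edge whose inner end notices the disagreement,
and that end is within `2 * h` hops of `v` by way of `y`. -/
theorem Connected.flood_agreeBit_eq_zero (hG : G.Connected) (hf : Function.Injective f) {h : ℕ}
    (ha : ¬ G.FloodAgrees f h) {q : ℕ} (hq : 2 * h ≤ q) (v : V) :
    G.flood (G.agreeBit f h) q v = 0 := by
  obtain ⟨u, hu⟩ : ∃ u, G.flood f h u ≠ G.flood f h v := by
    by_contra! hc
    exact ha fun a b => (hc a).trans (hc b).symm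
  obtain ⟨y, p, hp, hy⟩ := exists_flood_eq (G := G) (f := f) h v
  obtain ⟨r⟩ := hG.preconnected v u
  obtain ⟨d, -, hd1, hd2⟩ := r.exists_boundary_dart {z | G.flood f h z = G.flood f h v} rfl hu
  obtain ⟨y', p', hp', hy'⟩ := exists_flood_eq (G := G) (f := f) h d.fst
  obtain rfl : y' = y := hf (hy'.symm.trans (Eq.trans hd1 hy))
  have h0 : G.agreeBit f h d.fst = 0 :=
    if_pos ⟨d.snd, d.adj.symm, fun hc => hd2 (hc.trans hd1)⟩
  have h1 := flood_le (f := G.agreeBit f h) (q := q) (p.append p'.reverse)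
    (by rw [Walk.length_append, Walk.length_reverse]; omega)
  omega

theorem Connected.floodAgrees (hG : G.Connected) {h : ℕ} (hd : ∀ u v, G.dist u v ≤ h) :
    G.FloodAgrees f h := by
  have key : ∀ u v, G.flood f h u ≤ G.flood f h v := fun u v => by
    obtain ⟨y, -, -, hy⟩ := exists_flood_eq (G := G) (f := f) h v
    obtain ⟨p, hp⟩ := hG.exists_walk_length_eq_dist u y
    rw [hy]
    exact flood_le p (hp.trans_le (hd u y))
  exact fun u v => le_antisymm (key u v) (key v u)

end SimpleGraph

/-! ### Executing broadcast algorithms. -/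

namespace CongestAlgorithm

variable {b n : ℕ} (P : CongestAlgorithm b) (N : Network n) (ω : Fin n → P.Seed)

/-- Allows a run to be guessed globally, by a closed formula, and then checked against the local
rules one round at a time. -/
theorem config_eq_of_step {σ : ℕ → Fin n → P.State} {R : ℕ}
    (h0 : ∀ v, P.init (N.ident v) (N.links v) (ω v) = σ 0 v)
    (hout : ∀ r < R, ∀ v, P.output (σ r v) = none)
    (hstep : ∀ r < R, ∀ v, P.receive (σ r v) (P.inbox N (σ r) v) = σ (r + 1) v) :
    ∀ r ≤ R, P.config N ω r = σ r := by
  intro r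
  induction r with
  | zero => exact fun _ => funext h0
  | succ r ih =>
    intro hr
    funext v
    change (if (P.output (P.config N ω r v)).isSome then P.config N ω r v
      else P.receive (P.config N ω r v) (P.inbox N (P.config N ω r) v)) = _
    rw [ih (Nat.le_of_succ_le hr), hout r hr v, if_neg (by simp), hstep r hr v]

theorem config_eq_of_halted {R : ℕ} (h : ∀ v, (P.output (P.config N ω R v)).isSome) {r : ℕ}
    (hr : R ≤ r) : P.config N ω r = P.config N ω R := by
  induction r, hr using Nat.le_induction with
  | base => rfl
  | succ r _ ih =>
    funext v
    change (if (P.output (P.config N ω r v)).isSome then P.config N ω r v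
      else P.receive (P.config N ω r v) (P.inbox N (P.config N ω r) v)) = _
    rw [ih, if_pos (h v)]

end CongestAlgorithm

/-- Bit strings of length `b` are numbers below `2 ^ b`. -/
noncomputable def bitsEquiv (b : ℕ) : (Fin b → Bool) ≃ Fin (2 ^ b) :=
  Fintype.equivFinOfCardEq (by simp)

/-- The bit string that encodes a number below `2 ^ b`. -/
noncomputable def encodeBits (b m : ℕ) : Fin b → Bool :=
  if h : m < 2 ^ b then (bitsEquiv b).symm ⟨m, h⟩ else fun _ => false

theorem bitsEquiv_encodeBits {b m : ℕ} (h : m < 2 ^ b) : (bitsEquiv b (encodeBits b m) : ℕ) = m := by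
  simp [encodeBits, h]

/-- Everything that a node knows: its identifier, its incident links, its seed, the number of rounds
so far, and the messages received in each of them together with their senders. -/
structure View (Ω : Type) where
  me : ℕ
  links : Set (ℕ × ℕ)
  seed : Ω
  time : ℕ
  history : ℕ → Set (ℕ × ℕ)

/-- The algorithm in which a node remembers its view, broadcasts a number that depends on its view
and computes its output from its view. -/
noncomputable def broadcastAlgorithm (b : ℕ) {Ω : Type} [MeasurableSpace Ω] [StandardBorelSpace Ω]
    (law : MeasureTheory.Measure Ω) [MeasureTheory.IsProbabilityMeasure law]
    (act : View Ω → Option ℕ) (out : View Ω → Option ℝ) : CongestAlgorithm b where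
  Seed := Ω
  seedLaw := law
  State := View Ω
  init i L s := ⟨i, L, s, 0, fun _ => ∅⟩
  send x _ := (act x).map (encodeBits b)
  receive x M := { x with
    time := x.time + 1
    history := Function.update x.history x.time ((fun p => (p.1, (bitsEquiv b p.2 : ℕ))) '' M) }
  output := out

namespace Network

variable {n : ℕ} (N : Network n) {Ω : Type}

/-- The messages that `v` receives in round `q` if `M` lists the messages broadcast. -/
def broadcastInbox (M : ℕ → Fin n → Option ℕ) (v : Fin n) (q : ℕ) : Set (ℕ × ℕ) :=
  {p | ∃ u, N.graph.Adj u v ∧ N.ident u = p.1 ∧ M q u = some p.2}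

/-- The view of `v` after `r` rounds if `M` lists the messages broadcast. -/
def broadcastView (ω : Fin n → Ω) (M : ℕ → Fin n → Option ℕ) (r : ℕ) (v : Fin n) : View Ω where
  me := N.ident v
  links := N.links v
  seed := ω v
  time := r
  history := fun q => {p | q < r ∧ p ∈ N.broadcastInbox M v q}

variable {N} in
theorem history_broadcastView {ω : Fin n → Ω} {M : ℕ → Fin n → Option ℕ} {q r : ℕ} (hq : q < r)
    (v : Fin n) : (N.broadcastView ω M r v).history q = N.broadcastInbox M v q :=
  Set.ext fun _ => and_iff_right hq

end Network

section

variable {b n : ℕ} {Ω : Type} [MeasurableSpace Ω] [StandardBorelSpace Ω]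
  {law : MeasureTheory.Measure Ω} [MeasureTheory.IsProbabilityMeasure law]
  {act : View Ω → Option ℕ} {out : View Ω → Option ℝ} {N : Network n} {ω : Fin n → Ω}
  {M : ℕ → Fin n → Option ℕ} {R : ℕ}

theorem config_broadcastAlgorithm
    (hM : ∀ r < R, ∀ v, ∀ m ∈ M r v, m < 2 ^ b)
    (hact : ∀ r < R, ∀ v, act (N.broadcastView ω M r v) = M r v)
    (hout : ∀ r < R, ∀ v, out (N.broadcastView ω M r v) = none) :
    ∀ r ≤ R, (broadcastAlgorithm b law act out).config N ω r = N.broadcastView ω M r := by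
  refine (broadcastAlgorithm b law act out).config_eq_of_step N ω (fun v => ?_) hout
    fun r hr v => ?_
  · simp [broadcastAlgorithm, Network.broadcastView]
  have hinbox : (fun p => (p.1, (bitsEquiv b p.2 : ℕ))) ''
      (broadcastAlgorithm b law act out).inbox N (N.broadcastView ω M r) v =
      N.broadcastInbox M v r := by
    have hsend : ∀ u, (broadcastAlgorithm b law act out).send (N.broadcastView ω M r u)
        (N.ident v) = (M r u).map (encodeBits b) := fun u =>
      congrArg (Option.map (encodeBits b)) (hact r hr u)
    ext ⟨i, m⟩
    constructor
    · rintro ⟨⟨i', x⟩, ⟨u, hadj, -, hi, hx⟩, hp⟩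
      obtain ⟨m', hm', rfl⟩ := Option.map_eq_some_iff.mp ((hsend u).symm.trans hx)
      obtain ⟨rfl, rfl⟩ := Prod.mk.inj hp
      refine ⟨u, hadj, hi, ?_⟩
      rw [bitsEquiv_encodeBits (hM r hr u m' hm')]
      exact hm'
    · rintro ⟨u, hadj, hi, hm⟩
      -- Halted nodes fall silent; since nobody halts before round `R`, no listed message is lost.
      refine ⟨(i, encodeBits b m), ⟨u, hadj, hout r hr u, hi, ?_⟩, ?_⟩
      · exact (hsend u).trans (Option.map_eq_some_iff.mpr ⟨m, hm, rfl⟩)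
      · simp only [bitsEquiv_encodeBits (hM r hr u m hm)]
  change View.mk (N.ident v) (N.links v) (ω v) (r + 1) (Function.update _ r _) = _
  rw [hinbox, Network.broadcastView, View.mk.injEq]
  refine ⟨rfl, rfl, rfl, rfl, funext fun q => ?_⟩
  by_cases hq : q = r
  · subst hq
    rw [Function.update_self]
    exact (Network.history_broadcastView q.lt_succ_self v).symm
  · rw [Function.update_of_ne hq]
    have : q < r ↔ q < r + 1 := by omega
    simp [Network.broadcastView, this]

theorem output_broadcastAlgorithm
    (hM : ∀ r < R, ∀ v, ∀ m ∈ M r v, m < 2 ^ b)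
    (hact : ∀ r < R, ∀ v, act (N.broadcastView ω M r v) = M r v)
    (hout : ∀ r < R, ∀ v, out (N.broadcastView ω M r v) = none) {x : ℝ}
    (hx : ∀ v, out (N.broadcastView ω M R v) = some x) {r : ℕ} (hr : R ≤ r) :
    (broadcastAlgorithm b law act out).Outputs N ω r x := by
  have h := config_broadcastAlgorithm (law := law) hM hact hout R le_rfl
  have h' : ∀ v, (broadcastAlgorithm b law act out).output
      ((broadcastAlgorithm b law act out).config N ω R v) = some x := by rw [h]; exact hx
  intro v
  have h2 := CongestAlgorithm.config_eq_of_halted (broadcastAlgorithm b law act out) N ω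
    (fun v => by rw [h' v]; rfl) hr
  exact (congrArg _ (congrFun h2 v)).trans (h' v)

end

/-! ### The algorithm as a function of the local views. -/

/-- The message that announces a pair satisfying `p`. -/
noncomputable def pairMessage (p : ℕ × ℕ → Prop) : Option ℕ :=
  open Classical in if h : ∃ x, p x then some (Nat.pair h.choose.1 h.choose.2) else none

theorem pairMessage_eq_some_iff {p : ℕ × ℕ → Prop} (hp : ∀ x y, p x → p y → x = y) {m : ℕ} :
    pairMessage p = some m ↔ ∃ x, p x ∧ m = Nat.pair x.1 x.2 := by
  rw [pairMessage]
  split_ifs with h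
  · rw [Option.some_inj]
    constructor
    · rintro rfl
      exact ⟨_, h.choose_spec, rfl⟩
    · rintro ⟨x, hx, rfl⟩
      rw [hp _ _ h.choose_spec hx]
  · exact ⟨fun hc => by simp at hc, fun ⟨x, hx, _⟩ => absurd ⟨x, hx⟩ h⟩

/-- The costs of the cycles that a node with links `L` recognizes from the pairs that it announced
itself and from the pairs heard from its neighbours. -/
def cycleCandidates (L : Set (ℕ × ℕ)) (scale : ℕ → ℕ) (announced heard : Set (ℕ × ℕ)) : Set ℕ :=
  {X | ∃ d i, (d, i) ∈ announced ∧ ∃ j ω d', (j, ω) ∈ L ∧ (j, Nat.pair d' i) ∈ heard ∧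
    d' < d + scale ω ∧ (d = 0 ∨ ∃ j₀ ω₀ d₀, j₀ ≠ j ∧ (j₀, ω₀) ∈ L ∧
      (j₀, Nat.pair d₀ i) ∈ heard ∧ d₀ + scale ω₀ = d) ∧ X = d + scale ω + d'}

/-- The parameters of the algorithm: it runs `instances` many source detections for `duration` rounds
each; instance `ι` uses the weights rescaled by `scale ι`, and a node is a source if its seed lies in
`sources ι`. A recognized cycle of rescaled cost `X` counts as `value ι X`, and `cap` is used if there
is none. Identifiers are below `modulus`. -/
structure Plan (Ω : Type) where
  duration : ℕ
  instances : ℕ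
  modulus : ℕ
  cap : ℕ
  scale : ℕ → ℕ → ℕ
  value : ℕ → ℕ → ℕ
  sources : ℕ → Set Ω

namespace Plan

variable {Ω : Type} (P : Plan Ω)

/-- The number of rounds of all source detections. -/
def detectionTime : ℕ := P.instances * P.duration

/-- The messages that a node received in the first `q` rounds of an instance. -/
def heard (x : View Ω) (ι q : ℕ) : Set (ℕ × ℕ) :=
  {m | ∃ q' < q, m ∈ x.history (ι * P.duration + q')}

/-- The pair that a node announces in round `q` of an instance. -/
def Due (x : View Ω) (ι q : ℕ) (p : ℕ × ℕ) : Prop :=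
  IsDue (estimates x.me x.links (P.scale ι) (x.seed ∈ P.sources ι) (P.heard x ι q)) q p

/-- The smallest value of a cycle, given the pairs announced and heard in each instance. -/
noncomputable def estimate (L : Set (ℕ × ℕ)) (announced heard : ℕ → Set (ℕ × ℕ)) : ℕ :=
  sInf (insert P.cap {y | ∃ ι < P.instances,
    ∃ X ∈ cycleCandidates L (P.scale ι) (announced ι) (heard ι), y = P.value ι X})

/-- The estimate of a node, made unique by its identifier. -/
noncomputable def key (x : View Ω) : ℕ :=
  P.estimate x.links (fun ι => {p | ∃ q < P.duration, P.Due x ι q p})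
    (fun ι => P.heard x ι P.duration) * P.modulus + x.me

end Plan

/-- Flooding of minima that begins in round `start` with the value `a`, as seen by one node. -/
noncomputable def localFlood (history : ℕ → Set (ℕ × ℕ)) (start a : ℕ) : ℕ → ℕ
  | 0 => a
  | q + 1 => sInf (insert (localFlood history start a q) {m | ∃ j, (j, m) ∈ history (start + q)})

/-- The radius of the phase that takes place `e` rounds after the source detections. -/
def phaseRadius (e : ℕ) : ℕ := 2 ^ (Nat.log 2 e - 2)

/-- Offsets from 4h up to 8h, with h = 2^i, have binary logarithm i + 2, so the phases follow each
other without gaps. -/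
theorem phaseRadius_eq {i q : ℕ} (hq : q < 4 * 2 ^ i) :
    phaseRadius (4 * 2 ^ i + q) = 2 ^ i := by
  have h0 : 1 ≤ 2 ^ i := Nat.one_le_two_pow
  have h2 : Nat.log 2 (4 * 2 ^ i + q) = i + 2 := by
    rw [Nat.log_eq_iff (by simp)]
    constructor <;> rw [pow_succ, pow_succ] <;> omega
  rw [phaseRadius, h2, Nat.add_sub_cancel]

namespace Plan

variable {Ω : Type} (P : Plan Ω)

/-- The minimum that a node knows after `q` rounds of the phase with radius `h`. -/
noncomputable def phaseMin (x : View Ω) (h q : ℕ) : ℕ :=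
  localFlood x.history (P.detectionTime + 4 * h) (P.key x) q

/-- Whether a node noticed that no neighbour has another minimum. -/
noncomputable def phaseBit (x : View Ω) (h : ℕ) : ℕ :=
  open Classical in
    if ∃ j m, (j, m) ∈ x.history (P.detectionTime + 4 * h + h) ∧ m ≠ P.phaseMin x h h then 0 else 1

/-- What a node knows after `q` rounds of flooding the disagreement bits. -/
noncomputable def phaseFlag (x : View Ω) (h q : ℕ) : ℕ :=
  localFlood x.history (P.detectionTime + 4 * h + (h + 1)) (P.phaseBit x h) q

/-- The message that a node broadcasts `e` rounds after the source detections, in a phase with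
radius `h`. -/
noncomputable def phaseMessage (x : View Ω) (h e : ℕ) : Option ℕ :=
  some (if e - 4 * h ≤ h then P.phaseMin x h (e - 4 * h) else P.phaseFlag x h (e - 4 * h - (h + 1)))

/-- The message that a node broadcasts. After the source detections, the phase with radius
`h = 2 ^ i` takes the rounds from `4 * h` to `8 * h`. -/
noncomputable def act (x : View Ω) : Option ℕ :=
  if x.time < P.detectionTime then
    pairMessage (P.Due x (x.time / P.duration) (x.time % P.duration))
  -- The first phase has radius 1 and begins at offset 4, so four rounds stay idle.
  else if x.time < P.detectionTime + 4 then none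
  else
    P.phaseMessage x (phaseRadius (x.time - P.detectionTime)) (x.time - P.detectionTime)

open Classical in
/-- A node halts at the end of the first phase in which all nodes agree. -/
noncomputable def out (x : View Ω) : Option ℝ :=
  if h : ∃ i, x.time = P.detectionTime + 8 * 2 ^ i ∧ P.phaseFlag x (2 ^ i) (3 * 2 ^ i - 1) = 1 then
    some ((P.phaseMin x (2 ^ h.choose) (2 ^ h.choose) / P.modulus : ℕ) : ℝ)
  else none

end Plan

/-! ### The global run, and its agreement with the local rules. -/

namespace Network

variable {n : ℕ} (N : Network n) {Ω : Type} (P : Plan Ω) (ω : Fin n → Ω)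

/-- The pairs that `v` announces in an instance. -/
def announcements (scale : ℕ → ℕ) (S : Set (Fin n)) (T : ℕ) (v : Fin n) : Set (ℕ × ℕ) :=
  {p | ∃ q < T, ∃ x, N.Announces scale S v q x ∧ p = (N.scaledDist scale x v, N.ident x)}

/-- The pairs that `v` hears in the first `q` rounds of an instance. -/
def detectionHeard (scale : ℕ → ℕ) (S : Set (Fin n)) (v : Fin n) (q : ℕ) : Set (ℕ × ℕ) :=
  {m | ∃ q' < q, m ∈ N.detectionInbox scale S v q'}

/-- The sources of an instance. -/
def sourceSet (ι : ℕ) : Set (Fin n) := {x | ω x ∈ P.sources ι}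

/-- The estimate of `v` after the source detections. -/
noncomputable def cycleEstimate (v : Fin n) : ℕ :=
  P.estimate (N.links v)
    (fun ι => N.announcements (P.scale ι) (sourceSet P ω ι) P.duration v)
    (fun ι => N.detectionHeard (P.scale ι) (sourceSet P ω ι) v P.duration)

/-- The estimate of `v`, made unique by its identifier. -/
noncomputable def cycleKey (v : Fin n) : ℕ := N.cycleEstimate P ω v * P.modulus + N.ident v

/-- The message of `v` in a phase with radius `h`, `e` rounds after the source detections. -/
noncomputable def floodMessage (h e : ℕ) (v : Fin n) : Option ℕ :=
  some (if e - 4 * h ≤ h then N.graph.flood (N.cycleKey P ω) (e - 4 * h) v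
    else N.graph.flood (N.graph.agreeBit (N.cycleKey P ω) h) (e - 4 * h - (h + 1)) v)

/-- The messages of the whole run. -/
noncomputable def planMessage (r : ℕ) (v : Fin n) : Option ℕ :=
  if r < P.detectionTime then
    pairMessage (fun p => ∃ x, N.Announces (P.scale (r / P.duration))
      (sourceSet P ω (r / P.duration)) v (r % P.duration) x ∧
      p = (N.scaledDist (P.scale (r / P.duration)) x v, N.ident x))
  else if r < P.detectionTime + 4 then none
  else
    N.floodMessage P ω (phaseRadius (r - P.detectionTime)) (r - P.detectionTime) v

variable {N P ω}

theorem planMessage_detection {ι q : ℕ} (hι : ι < P.instances) (hq : q < P.duration) (v : Fin n)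
    {m : ℕ} : N.planMessage P ω (ι * P.duration + q) v = some m ↔
      ∃ x, N.Announces (P.scale ι) (sourceSet P ω ι) v q x ∧
        m = Nat.pair (N.scaledDist (P.scale ι) x v) (N.ident x) := by
  have hlt : ι * P.duration + q < P.detectionTime := by
    have := Nat.mul_le_mul_right P.duration (Nat.succ_le_of_lt hι)
    rw [Nat.succ_mul] at this
    rw [Plan.detectionTime]
    omega
  have h1 : (ι * P.duration + q) / P.duration = ι := by
    rw [mul_comm, Nat.mul_add_div (by omega), Nat.div_eq_of_lt hq, add_zero]
  have h2 : (ι * P.duration + q) % P.duration = q := by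
    rw [mul_comm, Nat.mul_add_mod, Nat.mod_eq_of_lt hq]
  rw [planMessage, if_pos hlt, h1, h2, pairMessage_eq_some_iff]
  · simp
  · rintro _ _ ⟨x, hx, rfl⟩ ⟨y, hy, rfl⟩
    rw [hx.eq hy]

theorem planMessage_phase {i q : ℕ} (hq : q < 4 * 2 ^ i) (v : Fin n) :
    N.planMessage P ω (P.detectionTime + 4 * 2 ^ i + q) v =
      some (if q ≤ 2 ^ i then N.graph.flood (N.cycleKey P ω) q v
        else N.graph.flood (N.graph.agreeBit (N.cycleKey P ω) (2 ^ i)) (q - (2 ^ i + 1)) v) := by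
  have h0 : 1 ≤ 2 ^ i := Nat.one_le_two_pow
  have h1 : P.detectionTime + 4 * 2 ^ i + q - P.detectionTime = 4 * 2 ^ i + q := by omega
  rw [planMessage, if_neg (by omega), if_neg (by omega), h1, phaseRadius_eq hq, floodMessage,
    Nat.add_sub_cancel_left]

variable {M : ℕ → Fin n → Option ℕ}

theorem heard_broadcastView {ι q r : ℕ} (hι : ι < P.instances) (hq : q ≤ P.duration)
    (hr : ι * P.duration + q ≤ r) (v : Fin n) :
    P.heard (N.broadcastView ω (N.planMessage P ω) r v) ι q =
      N.detectionHeard (P.scale ι) (sourceSet P ω ι) v q := by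
  ext ⟨j, m⟩
  refine exists_congr fun q' => and_congr_right fun hq' => ?_
  rw [history_broadcastView (by omega)]
  constructor
  · rintro ⟨u, hadj, rfl, hm⟩
    obtain ⟨x, hx, rfl⟩ := (planMessage_detection hι (hq'.trans_le hq) u).mp hm
    exact ⟨u, x, hadj, hx, rfl⟩
  · rintro ⟨u, x, hadj, hx, hp⟩
    obtain ⟨rfl, rfl⟩ := Prod.mk.inj hp
    exact ⟨u, hadj, rfl, (planMessage_detection hι (hq'.trans_le hq) u).mpr ⟨x, hx, rfl⟩⟩

theorem due_broadcastView (hs : ∀ ι ω, 1 ≤ ω → 1 ≤ P.scale ι ω) {ι q r : ℕ}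
    (hι : ι < P.instances) (hq : q ≤ P.duration) (hr : ι * P.duration + q ≤ r) (v : Fin n)
    (p : ℕ × ℕ) : P.Due (N.broadcastView ω (N.planMessage P ω) r v) ι q p ↔
      ∃ x, N.Announces (P.scale ι) (sourceSet P ω ι) v q x ∧
        p = (N.scaledDist (P.scale ι) x v, N.ident x) := by
  rw [Plan.Due, heard_broadcastView hι hq hr]
  exact isDue_estimates_iff (S := sourceSet P ω ι) (hs ι) v q p

theorem key_broadcastView (hs : ∀ ι ω, 1 ≤ ω → 1 ≤ P.scale ι ω) {r : ℕ}
    (hr : P.detectionTime ≤ r) (v : Fin n) :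
    P.key (N.broadcastView ω (N.planMessage P ω) r v) = N.cycleKey P ω v := by
  have hlt : ∀ ι < P.instances, ∀ q ≤ P.duration, ι * P.duration + q ≤ r := fun ι hι q hq => by
    have := Nat.mul_le_mul_right P.duration (Nat.succ_le_of_lt hι)
    rw [Nat.succ_mul] at this
    rw [Plan.detectionTime] at hr
    omega
  rw [Plan.key, cycleKey]
  congr 2
  rw [cycleEstimate, Plan.estimate, Plan.estimate]
  congr 2
  ext y
  refine exists_congr fun ι => and_congr_right fun hι => ?_
  have h1 : {p | ∃ q < P.duration, P.Due (N.broadcastView ω (N.planMessage P ω) r v) ι q p} =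
      N.announcements (P.scale ι) (sourceSet P ω ι) P.duration v := by
    ext p
    exact exists_congr fun q => and_congr_right fun hq =>
      due_broadcastView hs hι hq.le (hlt ι hι q hq.le) v p
  rw [h1, heard_broadcastView hι le_rfl (hlt ι hι _ le_rfl)]
  rfl

theorem localFlood_broadcastView {f : Fin n → ℕ} {start q r : ℕ} (hr : start + q ≤ r)
    (hM : ∀ q' < q, ∀ u, M (start + q') u = some (N.graph.flood f q' u)) (v : Fin n) :
    localFlood (N.broadcastView ω M r v).history start (f v) q = N.graph.flood f q v := by
  induction q with
  | zero => rfl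
  | succ q ih =>
    rw [localFlood, SimpleGraph.flood, ih (by omega) fun q' hq' => hM q' (by omega),
      history_broadcastView (by omega)]
    congr 2
    ext m
    simp [broadcastInbox, hM q (by omega)]

theorem phaseMin_broadcastView (hs : ∀ ι ω, 1 ≤ ω → 1 ≤ P.scale ι ω) {i q r : ℕ}
    (hq : q ≤ 2 ^ i) (hr : P.detectionTime + 4 * 2 ^ i + q ≤ r) (v : Fin n) :
    P.phaseMin (N.broadcastView ω (N.planMessage P ω) r v) (2 ^ i) q =
      N.graph.flood (N.cycleKey P ω) q v := by
  rw [Plan.phaseMin, key_broadcastView hs (by omega)]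
  refine localFlood_broadcastView hr (fun q' hq' u => ?_) v
  rw [planMessage_phase (by omega), if_pos (by omega)]

theorem phaseBit_broadcastView (hs : ∀ ι ω, 1 ≤ ω → 1 ≤ P.scale ι ω) {i r : ℕ}
    (hr : P.detectionTime + 4 * 2 ^ i + (2 ^ i + 1) ≤ r) (v : Fin n) :
    P.phaseBit (N.broadcastView ω (N.planMessage P ω) r v) (2 ^ i) =
      N.graph.agreeBit (N.cycleKey P ω) (2 ^ i) v := by
  rw [Plan.phaseBit, phaseMin_broadcastView hs le_rfl (by omega), SimpleGraph.agreeBit,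
    history_broadcastView (by omega)]
  congr 1
  have h0 : 1 ≤ 2 ^ i := Nat.one_le_two_pow
  rw [eq_iff_iff]
  constructor
  · rintro ⟨j, m, ⟨u, hadj, -, hm⟩, hne⟩
    rw [planMessage_phase (by omega), if_pos le_rfl, Option.some_inj] at hm
    exact ⟨u, hadj, by rwa [hm]⟩
  · rintro ⟨u, hadj, hne⟩
    refine ⟨N.ident u, _, ⟨u, hadj, rfl, ?_⟩, hne⟩
    rw [planMessage_phase (by omega), if_pos le_rfl]

theorem phaseFlag_broadcastView (hs : ∀ ι ω, 1 ≤ ω → 1 ≤ P.scale ι ω) {i q r : ℕ}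
    (hq : q < 3 * 2 ^ i) (hr : P.detectionTime + 4 * 2 ^ i + (2 ^ i + 1) + q ≤ r) (v : Fin n) :
    P.phaseFlag (N.broadcastView ω (N.planMessage P ω) r v) (2 ^ i) q =
      N.graph.flood (N.graph.agreeBit (N.cycleKey P ω) (2 ^ i)) q v := by
  rw [Plan.phaseFlag, phaseBit_broadcastView hs (by omega)]
  refine localFlood_broadcastView (by omega) (fun q' hq' u => ?_) v
  rw [add_assoc _ (2 ^ i + 1), planMessage_phase (by omega), if_neg (by omega),
    Nat.add_sub_cancel_left]

theorem act_broadcastView (hs : ∀ ι ω, 1 ≤ ω → 1 ≤ P.scale ι ω) (r : ℕ) (v : Fin n) :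
    P.act (N.broadcastView ω (N.planMessage P ω) r v) = N.planMessage P ω r v := by
  have htime : (N.broadcastView ω (N.planMessage P ω) r v).time = r := rfl
  rw [Plan.act, htime]
  by_cases h1 : r < P.detectionTime
  · rw [planMessage, if_pos h1, if_pos h1]
    congr 1
    funext p
    have hT : 0 < P.duration := by
      by_contra hc
      rw [Plan.detectionTime, Nat.eq_zero_of_not_pos hc] at h1
      simp at h1
    exact propext (due_broadcastView hs (Nat.div_lt_of_lt_mul (by rwa [mul_comm]))
      (Nat.mod_lt _ hT).le (Nat.div_add_mod' r P.duration).le v p)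
  · by_cases h2 : r < P.detectionTime + 4
    · rw [planMessage, if_neg h1, if_neg h1, if_pos h2, if_pos h2]
    · obtain ⟨i, q, hq, rfl⟩ : ∃ i q, q < 4 * 2 ^ i ∧ r = P.detectionTime + 4 * 2 ^ i + q := by
        have h3 : 2 ^ 2 ≤ r - P.detectionTime := by omega
        have h4 := Nat.le_log_of_pow_le (b := 2) (by simp) h3
        obtain ⟨i, hi⟩ := Nat.exists_eq_add_of_le h4
        have h5 := Nat.pow_log_le_self 2 (x := r - P.detectionTime) (by omega)
        have h6 := Nat.lt_pow_succ_log_self (b := 2) (by simp) (r - P.detectionTime)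
        rw [hi, pow_add] at h5
        rw [hi, pow_succ, pow_add] at h6
        exact ⟨i, r - P.detectionTime - 4 * 2 ^ i, by omega, by omega⟩
      have h0 : 1 ≤ 2 ^ i := Nat.one_le_two_pow
      have h3 : P.detectionTime + 4 * 2 ^ i + q - P.detectionTime = 4 * 2 ^ i + q := by omega
      rw [if_neg h1, if_neg h2, h3, phaseRadius_eq hq, Plan.phaseMessage, Nat.add_sub_cancel_left,
        planMessage_phase hq]
      congr 1
      split_ifs with h5
      · rw [phaseMin_broadcastView hs h5 le_rfl]
      · rw [phaseFlag_broadcastView hs (by omega) (by omega)]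

/-- The remainder modulo `P.modulus` recovers the identifier. Distinct keys are what the test of
agreement relies on. -/
theorem cycleKey_injective (hid : ∀ v, N.ident v < P.modulus) :
    Function.Injective (N.cycleKey P ω) := by
  intro u v huv
  have h1 := congrArg (· % P.modulus) huv
  refine N.ident_injective ?_
  simpa only [cycleKey, Nat.mul_add_mod_self_right, Nat.mod_eq_of_lt (hid _)] using h1

theorem cycleKey_div (hid : ∀ v, N.ident v < P.modulus) (v : Fin n) :
    N.cycleKey P ω v / P.modulus = N.cycleEstimate P ω v := by
  have := hid v
  rw [cycleKey, mul_comm, Nat.mul_add_div (by omega), Nat.div_eq_of_lt this, add_zero]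

/-- With agreement, all bits are 1. Otherwise a 0 reaches every node within 2h ≤ 3h - 1 rounds of
flooding bits. The halting condition is therefore global: all nodes halt in the same round. -/
theorem out_broadcastView (hs : ∀ ι ω, 1 ≤ ω → 1 ≤ P.scale ι ω)
    (hid : ∀ v, N.ident v < P.modulus) (r : ℕ) (v : Fin n) {x : ℝ} :
    P.out (N.broadcastView ω (N.planMessage P ω) r v) = some x ↔
      ∃ i, r = P.detectionTime + 8 * 2 ^ i ∧ N.graph.FloodAgrees (N.cycleKey P ω) (2 ^ i) ∧
        x = (N.graph.flood (N.cycleKey P ω) (2 ^ i) v / P.modulus : ℕ) := by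
  have h0 : ∀ i, 1 ≤ 2 ^ i := fun i => Nat.one_le_two_pow
  have hflag : ∀ i, r = P.detectionTime + 8 * 2 ^ i →
      (P.phaseFlag (N.broadcastView ω (N.planMessage P ω) r v) (2 ^ i) (3 * 2 ^ i - 1) = 1 ↔
        N.graph.FloodAgrees (N.cycleKey P ω) (2 ^ i)) := fun i hi => by
    have := h0 i
    rw [phaseFlag_broadcastView hs (by omega) (by omega)]
    refine ⟨fun h => ?_, fun h => h.flood_agreeBit_eq_one _ v⟩
    by_contra hc
    rw [N.connected.flood_agreeBit_eq_zero (cycleKey_injective hid) hc (by omega)] at h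
    exact zero_ne_one h
  have htime : (N.broadcastView ω (N.planMessage P ω) r v).time = r := rfl
  rw [Plan.out, htime]
  split_ifs with h
  · obtain ⟨h1, h2⟩ := h.choose_spec
    rw [phaseMin_broadcastView hs le_rfl (by omega), Option.some_inj]
    constructor
    · rintro rfl
      exact ⟨_, h1, (hflag _ h1).mp h2, rfl⟩
    · rintro ⟨i, hi, -, rfl⟩
      have : i = h.choose := Nat.pow_right_injective (le_refl 2) (by simp only; omega)
      rw [this]
  · simp only [false_iff]
    rintro ⟨i, hi, ha, -⟩
    exact h ⟨i, hi, (hflag i hi).mpr ha⟩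

/-- All messages of the run are below `m`. -/
theorem lt_of_planMessage {m : ℕ} (hT : ∀ d < P.duration, ∀ v, Nat.pair d (N.ident v) < m)
    (hc : P.cap * P.modulus + P.modulus ≤ m) (hm : 1 < m) (hid : ∀ v, N.ident v < P.modulus)
    (r : ℕ) (v : Fin n) (k : ℕ) (hk : k ∈ N.planMessage P ω r v) : k < m := by
  have hkey : ∀ v, N.cycleKey P ω v < m := fun v => by
    have h1 : N.cycleEstimate P ω v ≤ P.cap := Nat.sInf_le (Set.mem_insert _ _)
    have := Nat.mul_le_mul_right P.modulus h1
    have := hid v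
    rw [cycleKey]
    omega
  rw [Option.mem_def, planMessage] at hk
  split_ifs at hk with h1 h2
  · obtain ⟨_, ⟨x, hx, rfl⟩, rfl⟩ := (pairMessage_eq_some_iff (by
      rintro _ _ ⟨x, hx, rfl⟩ ⟨y, hy, rfl⟩
      rw [hx.eq hy])).mp hk
    have hT' : 0 < P.duration := by
      by_contra hc
      rw [Plan.detectionTime, Nat.eq_zero_of_not_pos hc] at h1
      simp at h1
    have h2 := Nat.mod_lt r hT'
    have h3 := hx.2
    exact hT _ (by omega) x
  · rw [floodMessage, Option.some_inj] at hk
    split_ifs at hk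
    · obtain ⟨u, -, -, hu⟩ := SimpleGraph.exists_flood_eq (G := N.graph)
        (f := N.cycleKey P ω) (r - P.detectionTime - 4 * phaseRadius (r - P.detectionTime)) v
      rw [← hk, hu]
      exact hkey u
    · obtain ⟨u, -, -, hu⟩ := SimpleGraph.exists_flood_eq (G := N.graph)
        (f := N.graph.agreeBit (N.cycleKey P ω) (phaseRadius (r - P.detectionTime)))
        (r - P.detectionTime - 4 * phaseRadius (r - P.detectionTime) -
          (phaseRadius (r - P.detectionTime) + 1)) v
      rw [← hk, hu, SimpleGraph.agreeBit]
      split_ifs <;> omega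

end Network

/-- The algorithm with the given parameters. -/
noncomputable def Plan.algorithm {Ω : Type} [MeasurableSpace Ω] [StandardBorelSpace Ω] (P : Plan Ω)
    (law : MeasureTheory.Measure Ω) [MeasureTheory.IsProbabilityMeasure law] (b : ℕ) :
    CongestAlgorithm b :=
  broadcastAlgorithm b law P.act P.out

/-- All nodes output the minimum of their estimates. -/
theorem Network.outputs_algorithm {n b : ℕ} {N : Network n} {Ω : Type} [MeasurableSpace Ω]
    [StandardBorelSpace Ω] {P : Plan Ω} {law : MeasureTheory.Measure Ω}
    [MeasureTheory.IsProbabilityMeasure law] (hs : ∀ ι ω, 1 ≤ ω → 1 ≤ P.scale ι ω)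
    (hid : ∀ v, N.ident v < P.modulus)
    (hT : ∀ d < P.duration, ∀ v, Nat.pair d (N.ident v) < 2 ^ b)
    (hc : P.cap * P.modulus + P.modulus ≤ 2 ^ b) (hb : 0 < b) (ω : Fin n → Ω) :
    ∃ u, (P.algorithm law b).Outputs N ω (P.detectionTime + 16 * N.graph.diam + 8)
      (N.cycleEstimate P ω u) ∧ ∀ v, N.cycleEstimate P ω u ≤ N.cycleEstimate P ω v := by
  classical
  have hagree : ∃ i, N.graph.FloodAgrees (N.cycleKey P ω) (2 ^ i) ∧
      8 * 2 ^ i ≤ 16 * N.graph.diam + 8 := by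
    -- The least power of two that reaches the diameter is 1 or less than twice the diameter.
    refine ⟨Nat.clog 2 N.graph.diam, N.connected.floodAgrees fun u v => ?_, ?_⟩
    · have : Nonempty (Fin n) := ⟨u⟩
      exact (SimpleGraph.dist_le_diam
        (SimpleGraph.connected_iff_ediam_ne_top.mp N.connected)).trans (Nat.le_pow_clog (by simp) _)
    · rcases Nat.eq_zero_or_pos N.graph.diam with h | h
      · simp [h]
      · rcases Nat.eq_or_lt_of_le (Nat.succ_le_of_lt h) with h1 | h1
        · simp [← h1]
        · have h2 := Nat.pow_pred_clog_lt_self (b := 2) (by simp) h1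
          have h3 : 0 < Nat.clog 2 N.graph.diam := Nat.clog_pos (by simp) h1
          obtain ⟨c, hc⟩ := Nat.exists_eq_succ_of_ne_zero h3.ne'
          rw [hc] at h2 ⊢
          rw [Nat.succ_eq_add_one, pow_succ]
          simp only [Nat.succ_eq_add_one, Nat.pred_succ] at h2
          omega
  have hex : ∃ i, N.graph.FloodAgrees (N.cycleKey P ω) (2 ^ i) :=
    ⟨hagree.choose, hagree.choose_spec.1⟩
  -- The run ends at the first radius with agreement, which may be smaller than the diameter.
  set i := Nat.find hex with hi
  have hia := Nat.find_spec hex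
  have hR : P.detectionTime + 8 * 2 ^ i ≤ P.detectionTime + 16 * N.graph.diam + 8 := by
    obtain ⟨j, hj, hle⟩ := hagree
    have := Nat.pow_le_pow_right (n := 2) (by simp) (Nat.find_min' hex hj)
    rw [← hi] at this
    omega
  obtain ⟨v₀⟩ := N.connected.nonempty
  obtain ⟨u, -, -, hu⟩ := SimpleGraph.exists_flood_eq (G := N.graph) (f := N.cycleKey P ω) (2 ^ i) v₀
  have hall : ∀ v, N.graph.flood (N.cycleKey P ω) (2 ^ i) v / P.modulus = N.cycleEstimate P ω u :=
    fun v => by rw [hia v v₀, hu, cycleKey_div hid]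
  refine ⟨u, ?_, fun v => ?_⟩
  · refine output_broadcastAlgorithm (R := P.detectionTime + 8 * 2 ^ i)
      (M := N.planMessage P ω) (fun r _ v m hm => ?_) (fun r _ v => act_broadcastView hs r v)
      (fun r hr v => ?_) (fun v => ?_) hR
    · exact lt_of_planMessage hT hc (Nat.one_lt_two_pow hb.ne') hid r v m hm
    · rw [Option.eq_none_iff_forall_ne_some]
      intro x hx
      obtain ⟨j, rfl, hj, -⟩ := (out_broadcastView hs hid r v).mp hx
      have := Nat.pow_le_pow_right (n := 2) (by simp) (Nat.find_min' hex hj)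
      rw [← hi] at this
      omega
    · exact (out_broadcastView hs hid _ v).mpr ⟨i, rfl, hia, by rw [hall]⟩
  · rw [← hall v, ← cycleKey_div hid v]
    exact Nat.div_le_div_right (hia.le v v)

/-! ### Independent seeds: the probability of missing the next level. -/

open MeasureTheory

/-- Some initial segment of `l` has `t` members with seed in `A \ B` and none with seed in `B`. -/
def MissesPrefix {V Ω : Type*} (A B : Set Ω) (l : List V) (t : ℕ) (ω : V → Ω) : Prop :=
  ∃ l₁, l₁ <+: l ∧ (∀ v ∈ l₁, ω v ∉ B) ∧ ∃ s : Finset V, t ≤ s.card ∧ ∀ v ∈ s, v ∈ l₁ ∧ ω v ∈ A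

section

variable {V Ω : Type*} {A B : Set Ω}

/-- Revealing the seed of `x`: outside `A` nothing changes, and in `A` it must miss `B` and uses up
one of the required members. -/
theorem MissesPrefix.cons {x : V} {l : List V} {t : ℕ} {ω : V → Ω}
    (h : MissesPrefix A B (x :: l) (t + 1) ω) :
    (ω x ∉ A ∧ MissesPrefix A B l (t + 1) ω) ∨ (ω x ∈ A \ B ∧ MissesPrefix A B l t ω) := by
  classical
  obtain ⟨l₁, hl, hB, s, hs, hA⟩ := h
  rcases List.prefix_cons_iff.mp hl with rfl | ⟨l₂, rfl, hl₂⟩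
  · obtain rfl : s = ∅ := Finset.eq_empty_of_forall_notMem fun v hv => by simpa using (hA v hv).1
    simp at hs
  · by_cases hx : ω x ∈ A
    · refine Or.inr ⟨⟨hx, hB x (by simp)⟩, l₂, hl₂, fun v hv => hB v (by simp [hv]), s.erase x, ?_,
        fun v hv => ?_⟩
      · have := Finset.pred_card_le_card_erase (s := s) (a := x)
        omega
      · obtain ⟨hvx, hv⟩ := Finset.mem_erase.mp hv
        exact ⟨by simpa [hvx] using (hA v hv).1, (hA v hv).2⟩
    · refine Or.inl ⟨hx, l₂, hl₂, fun v hv => hB v (by simp [hv]), s, hs, fun v hv => ?_⟩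
      have hvx : v ≠ x := by rintro rfl; exact hx (hA v hv).2
      exact ⟨by simpa [hvx] using (hA v hv).1, (hA v hv).2⟩

theorem missesPrefix_congr {l : List V} {t : ℕ} {ω ω' : V → Ω} (h : ∀ v ∈ l, ω v = ω' v) :
    MissesPrefix A B l t ω ↔ MissesPrefix A B l t ω' := by
  refine exists_congr fun l₁ => and_congr_right fun hl => ?_
  have h' : ∀ v ∈ l₁, ω v = ω' v := fun v hv => h v (hl.subset hv)
  refine and_congr (forall₂_congr fun v hv => by rw [h' v hv])
    (exists_congr fun s => and_congr_right fun _ => forall₂_congr fun v _ =>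
      and_congr_right fun hv => by rw [h' v hv])

end

section

variable {V Ω : Type*} [Fintype V] [MeasurableSpace Ω] {μ : Measure Ω} [IsProbabilityMeasure μ]
  {A B : Set Ω}

theorem measurableSet_missesPrefix (hA : MeasurableSet A) (hB : MeasurableSet B) (l : List V)
    (t : ℕ) : MeasurableSet {ω : V → Ω | MissesPrefix A B l t ω} := by
  have : {ω : V → Ω | MissesPrefix A B l t ω} =
      ⋃ l₁ ∈ {l₁ | l₁ <+: l}, (⋂ v ∈ {v | v ∈ l₁}, (fun ω : V → Ω => ω v) ⁻¹' Bᶜ) ∩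
        ⋃ s ∈ {s : Finset V | t ≤ s.card}, ⋂ v ∈ s, {ω : V → Ω | v ∈ l₁ ∧ ω v ∈ A} := by
    ext ω
    simp only [MissesPrefix, Set.mem_ofPred_eq, Set.mem_iUnion, Set.mem_inter_iff, Set.mem_iInter,
      Set.mem_preimage, Set.mem_compl_iff, exists_prop]
  rw [this]
  have hfin : {l₁ | l₁ <+: l}.Finite :=
    (List.finite_toSet l.inits).subset fun l₁ h => by simpa using h
  refine hfin.measurableSet_biUnion fun l₁ _ => MeasurableSet.inter ?_ ?_
  · exact (Set.toFinite _).measurableSet_biInter fun v _ => hB.compl.preimage (measurable_pi_apply v)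
  · refine (Set.toFinite _).measurableSet_biUnion fun s _ => s.measurableSet_biInter fun v _ => ?_
    exact (MeasurableSet.const _).inter (hA.preimage (measurable_pi_apply v))

/-- An event determined by the coordinates in `l` is independent of the coordinate `x`; the map
`ext` factors the event through the coordinates in `l`. -/
theorem pi_inter_of_congr [DecidableEq V] {x : V} {l : List V} (hx : x ∉ l) {C : Set Ω}
    (hC : MeasurableSet C) {E : Set (V → Ω)} (hE : MeasurableSet E)
    (hEl : ∀ ω ω' : V → Ω, (∀ v ∈ l, ω v = ω' v) → (ω ∈ E ↔ ω' ∈ E)) :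
    Measure.pi (fun _ : V => μ) ({ω | ω x ∈ C} ∩ E) = μ C * Measure.pi (fun _ : V => μ) E := by
  have hne : Nonempty Ω := nonempty_of_isProbabilityMeasure μ
  have hind : ProbabilityTheory.iIndepFun (fun (v : V) (ω : V → Ω) => ω v)
      (Measure.pi (fun _ : V => μ)) :=
    ProbabilityTheory.iIndepFun_pi (X := fun _ ω => ω) fun _ => aemeasurable_id
  have h2 := hind.indepFun_finset {x} l.toFinset (by simpa using hx) measurable_pi_apply
  let ext : (l.toFinset → Ω) → V → Ω := fun g v =>
    if h : v ∈ l.toFinset then g ⟨v, h⟩ else Classical.arbitrary Ω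
  have hext : Measurable ext := by
    refine measurable_pi_lambda _ fun v => ?_
    by_cases h : v ∈ l.toFinset
    · simp only [ext, dif_pos h]
      exact measurable_pi_apply (X := fun _ : l.toFinset => Ω) ⟨v, h⟩
    · simp only [ext, dif_neg h]
      exact measurable_const
  have h3 := h2.measure_inter_preimage_eq_mul
    ((fun g : (({x} : Finset V) → Ω) => g ⟨x, by simp⟩) ⁻¹' C) (ext ⁻¹' E)
    (hC.preimage (measurable_pi_apply _)) (hE.preimage hext)
  have hE' : (fun (a : V → Ω) (i : l.toFinset) => a i) ⁻¹' (ext ⁻¹' E) = E := by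
    ext ω
    refine hEl _ _ fun v hv => ?_
    simp [ext, hv]
  rw [hE'] at h3
  have h4 : Measure.pi (fun _ : V => μ) {ω | ω x ∈ C} = μ C :=
    (measurePreserving_eval (fun _ : V => μ) x).measure_preimage hC.nullMeasurableSet
  rw [← h4]
  exact h3

/-- If a seed in `A` misses `B` with conditional probability at most `c`, then the first `t` members
of a list with seed in `A` all miss `B` with probability at most `c ^ t`. -/
theorem pi_missesPrefix_le {c : ENNReal} (hA : MeasurableSet A) (hB : MeasurableSet B)
    (hc : μ (A \ B) ≤ c * μ A) {l : List V} (hl : l.Nodup) (t : ℕ) :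
    Measure.pi (fun _ : V => μ) {ω | MissesPrefix A B l t ω} ≤ c ^ t := by
  classical
  induction l generalizing t with
  | nil =>
    cases t with
    | zero => simpa using prob_le_one
    | succ t =>
      have : {ω : V → Ω | MissesPrefix A B [] (t + 1) ω} = ∅ := by
        refine Set.eq_empty_of_forall_notMem fun ω => ?_
        rintro ⟨l₁, hl, -, s, hs, hA⟩
        obtain rfl := List.prefix_nil.mp hl
        obtain rfl : s = ∅ :=
          Finset.eq_empty_of_forall_notMem fun v hv => by simpa using (hA v hv).1
        simp at hs
      simp [this]
  | cons x l ih =>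
    cases t with
    | zero => simpa using prob_le_one
    | succ t =>
      obtain ⟨hx, hl⟩ := List.nodup_cons.mp hl
      have hsub : {ω : V → Ω | MissesPrefix A B (x :: l) (t + 1) ω} ⊆
          ({ω | ω x ∈ Aᶜ} ∩ {ω | MissesPrefix A B l (t + 1) ω}) ∪
          ({ω | ω x ∈ A \ B} ∩ {ω | MissesPrefix A B l t ω}) := fun ω h => h.cons
      refine (measure_mono hsub).trans ((measure_union_le _ _).trans ?_)
      rw [pi_inter_of_congr hx hA.compl (measurableSet_missesPrefix hA hB l (t + 1))
          (fun _ _ h => missesPrefix_congr h),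
        pi_inter_of_congr hx (hA.diff hB) (measurableSet_missesPrefix hA hB l t)
          (fun _ _ h => missesPrefix_congr h)]
      -- Missing `B` at `x` contributes the factor `c` that the shorter requirement lacks, so both
      -- cases carry `c ^ (t + 1)`.
      calc _ ≤ μ Aᶜ * c ^ (t + 1) + (c * μ A) * c ^ t := by
            gcongr
            · exact ih hl (t + 1)
            · exact ih hl t
        _ = (μ Aᶜ + μ A) * c ^ (t + 1) := by ring
        _ = c ^ (t + 1) := by
            rw [add_comm, measure_add_measure_compl hA, measure_univ, one_mul]

end

/-! ### Soundness of the candidates and recognition of a cheap cycle. -/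

namespace Network

variable {n : ℕ} {N : Network n} {Ω : Type} {P : Plan Ω} {ω : Fin n → Ω}

/-- The cost of a walk with respect to rescaled weights. -/
def scaledCost (N : Network n) (scale : ℕ → ℕ) {u v : Fin n} (p : N.graph.Walk u v) : ℕ :=
  p.cost fun e => scale (N.weight e)

theorem announcements_subset {scale : ℕ → ℕ} {S : Set (Fin n)} {T : ℕ} {v : Fin n} {d i : ℕ}
    (h : (d, i) ∈ N.announcements scale S T v) :
    ∃ x, i = N.ident x ∧ d = N.scaledDist scale x v := by
  obtain ⟨q, -, x, -, hp⟩ := h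
  obtain ⟨rfl, rfl⟩ := Prod.mk.inj hp
  exact ⟨x, rfl, rfl⟩

theorem mem_detectionHeard_iff {scale : ℕ → ℕ} {S : Set (Fin n)} {q : ℕ} {u v : Fin n}
    (huv : N.graph.Adj v u) {x : Fin n} {d : ℕ} :
    (N.ident u, Nat.pair d (N.ident x)) ∈ N.detectionHeard scale S v q ↔
      d = N.scaledDist scale x u ∧ x ∈ S ∧ N.scaledDist scale x u +
        precedence S (fun x => N.scaledDist scale x u) N.ident x < q := by
  constructor
  · rintro ⟨q', hq', u', x', -, hx, hp⟩
    obtain ⟨h1, h2⟩ := Prod.mk.inj hp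
    obtain rfl := N.ident_injective h1
    obtain ⟨rfl, h3⟩ := Nat.pair_eq_pair.mp h2
    obtain rfl := N.ident_injective h3
    exact ⟨rfl, hx.1, hx.2 ▸ hq'⟩
  · rintro ⟨rfl, hx, hq⟩
    exact ⟨_, hq, u, x, huv.symm, ⟨hx, rfl⟩, rfl⟩

/-- Every candidate is an upper bound for the cost of a cycle. -/
theorem exists_isCycle_of_mem_cycleCandidates {scale : ℕ → ℕ} (hs : ∀ ω, 1 ≤ ω → 1 ≤ scale ω)
    {S : Set (Fin n)} {T : ℕ} {v : Fin n} {X : ℕ}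
    (hX : X ∈ cycleCandidates (N.links v) scale (N.announcements scale S T v)
      (N.detectionHeard scale S v T)) :
    ∃ (z : Fin n) (q : N.graph.Walk z z), q.IsCycle ∧ N.scaledCost scale q ≤ X := by
  obtain ⟨d, i, hd, j, _, d', ⟨u, hvu, rfl, rfl⟩, hd', hlt, hz, rfl⟩ := hX
  obtain ⟨x, rfl, rfl⟩ := announcements_subset hd
  obtain ⟨rfl, -, -⟩ := (mem_detectionHeard_iff hvu).mp hd'
  have hw : ∀ e ∈ N.graph.edgeSet, 1 ≤ scale (N.weight e) := fun e he =>
    hs _ (N.one_le_weight e he)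
  obtain ⟨q, hq, hle⟩ := N.connected.exists_isCycle_of_costDist
    (fun e => scale (N.weight e)) hw hvu hlt (x := x) (by
      rcases hz with hz | ⟨j₀, _, d₀, hne, ⟨u', hvu', rfl, rfl⟩, hd₀, hsum⟩
      · left
        -- Rescaled weights are positive, so distance 0 means that `v` is the source itself.
        by_contra hne
        obtain ⟨u', hu', heq⟩ := N.connected.exists_costDist_eq_add
          (fun e => scale (N.weight e)) (Ne.symm hne)
        have := hw _ ((SimpleGraph.mem_edgeSet _).mpr hu')
        rw [scaledDist] at hz
        omega
      · obtain ⟨rfl, -, -⟩ := (mem_detectionHeard_iff hvu').mp hd₀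
        exact Or.inr ⟨u', fun h => hne (by rw [h]), hvu', hsum⟩)
  exact ⟨v, q, hq, hle⟩

/-- Every candidate bounds the rescaled cost of a real cycle, so this holds for all seeds. -/
theorem le_cycleEstimate (hs : ∀ ι ω, 1 ≤ ω → 1 ≤ P.scale ι ω) {B : ℕ} (hcap : B ≤ P.cap)
    (hval : ∀ ι X (z : Fin n) (q : N.graph.Walk z z), q.IsCycle →
      N.scaledCost (P.scale ι) q ≤ X → B ≤ P.value ι X) (v : Fin n) :
    B ≤ N.cycleEstimate P ω v := by
  refine le_csInf ⟨_, Set.mem_insert _ _⟩ ?_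
  rintro y (rfl | ⟨ι, -, X, hX, rfl⟩)
  · exact hcap
  · obtain ⟨z, q, hq, hle⟩ := exists_isCycle_of_mem_cycleCandidates (hs ι) hX
    exact hval ι X z q hq hle

/-- If a source is detected by all nodes of a cycle, then the farthest of them recognizes a cheap
cycle. -/
theorem exists_cycleEstimate_le {ι : ℕ} (hι : ι < P.instances) {x : Fin n}
    (hx : x ∈ sourceSet P ω ι) {a : Fin n} {c : N.graph.Walk a a} (hc : c.IsCycle)
    (hdet : ∀ v ∈ c.support, N.scaledDist (P.scale ι) x v + precedence (sourceSet P ω ι)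
      (fun x => N.scaledDist (P.scale ι) x v) N.ident x < P.duration) {u : Fin n}
    (hs : ∀ ω, 1 ≤ ω → 1 ≤ P.scale ι ω) (hu : u ∈ c.support) :
    ∃ v X, X ≤ 2 * N.scaledDist (P.scale ι) x u + N.scaledCost (P.scale ι) c ∧
      N.cycleEstimate P ω v ≤ P.value ι X := by
  obtain ⟨z, hz, hfar⟩ :=
    N.connected.exists_farthest (fun e => P.scale ι (N.weight e)) x c hc
  have hself : (N.scaledDist (P.scale ι) x z, N.ident x) ∈
      N.announcements (P.scale ι) (sourceSet P ω ι) P.duration z :=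
    ⟨_, hdet z hz, x, ⟨hx, rfl⟩, rfl⟩
  have key : ∀ y ∈ c.support, N.graph.Adj z y →
      N.scaledDist (P.scale ι) x y ≤ N.scaledDist (P.scale ι) x z →
      N.scaledDist (P.scale ι) x z + P.scale ι (N.weight s(z, y)) + N.scaledDist (P.scale ι) x y ≤
        2 * N.scaledDist (P.scale ι) x u + N.scaledCost (P.scale ι) c →
      (N.scaledDist (P.scale ι) x z = 0 ∨ ∃ j₀ ω₀ d₀, j₀ ≠ N.ident y ∧ (j₀, ω₀) ∈ N.links z ∧
        (j₀, Nat.pair d₀ (N.ident x)) ∈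
          N.detectionHeard (P.scale ι) (sourceSet P ω ι) z P.duration ∧
        d₀ + P.scale ι ω₀ = N.scaledDist (P.scale ι) x z) →
      ∃ v X, X ≤ 2 * N.scaledDist (P.scale ι) x u + N.scaledCost (P.scale ι) c ∧
        N.cycleEstimate P ω v ≤ P.value ι X := by
    intro y hy hadj hle hcost hpar
    have h1 := hs _ (N.one_le_weight s(z, y) hadj)
    exact ⟨z, _, hcost, Nat.sInf_le (Set.mem_insert_of_mem _ ⟨ι, hι, _,
      ⟨_, _, hself, N.ident y, N.weight s(z, y), _, ⟨y, hadj, rfl, rfl⟩,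
        (mem_detectionHeard_iff hadj).mpr ⟨rfl, hx, hdet y hy⟩, by omega, hpar, rfl⟩, rfl⟩)⟩
  by_cases hxz : x = z
  · obtain ⟨y, hy, -, hadj, hle, hcost⟩ := hfar z
    exact key y hy hadj hle (hcost u hu) (Or.inl (by rw [hxz]; simp [scaledDist]))
  · obtain ⟨p, hp, heq⟩ :=
      N.connected.exists_costDist_eq_add (fun e => P.scale ι (N.weight e)) hxz
    obtain ⟨y, hy, hne, hadj, hle, hcost⟩ := hfar p
    refine key y hy hadj hle (hcost u hu) (Or.inr ⟨N.ident p, N.weight s(z, p), _,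
      fun h => hne (N.ident_injective h).symm, ⟨p, hp.symm, rfl, rfl⟩,
      (mem_detectionHeard_iff hp.symm).mpr ⟨rfl, hx, ?_⟩, ?_⟩)
    -- The parent `p` need not lie on the cycle, but it announces `x` earlier than `z` does, hence
    -- in time.
    · have h1 := precedence_le_of_scaledDist_eq (S := sourceSet P ω ι) hp heq
      have h2 := hdet z hz
      have h3 : N.scaledDist (P.scale ι) x z =
        N.scaledDist (P.scale ι) x p + P.scale ι (N.weight s(p, z)) := heq
      omega
    · rw [Sym2.eq_swap]
      exact heq.symm

/-- Descending through the levels, one finds a source that is near a given cycle and precedes all but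
few sources of its level at every node of the cycle. -/
theorem exists_level {scale : ℕ → ℕ} {S : ℕ → Set (Fin n)} {K t : ℕ} (h0 : S 0 = Set.univ)
    (hK : S K = ∅)
    (hmiss : ∀ i < K, ∀ v x, x ∈ S i →
      t ≤ precedence (S i) (fun x => N.scaledDist scale x v) N.ident x →
      ∃ y ∈ S (i + 1), toLex (N.scaledDist scale y v, N.ident y) <
        toLex (N.scaledDist scale x v, N.ident x))
    {a : Fin n} (c : N.graph.Walk a a) :
    ∃ i < K, ∃ x ∈ S i, ∃ u ∈ c.support,
      2 * N.scaledDist scale x u ≤ i * N.scaledCost scale c ∧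
      ∀ v ∈ c.support, precedence (S i) (fun x => N.scaledDist scale x v) N.ident x < t := by
  by_contra! hcon
  have key : ∀ i ≤ K, ∃ x ∈ S i, ∃ u ∈ c.support,
      2 * N.scaledDist scale x u ≤ i * N.scaledCost scale c := by
    intro i
    induction i with
    | zero => exact fun _ => ⟨a, h0 ▸ Set.mem_univ a, a, by simp, by simp [scaledDist]⟩
    | succ i ih =>
      intro hi
      obtain ⟨x, hx, u, hu, hle⟩ := ih (by omega)
      obtain ⟨v, hv, ht⟩ := hcon i hi x hx u hu hle
      obtain ⟨y, hy, hyx⟩ := hmiss i hi v x hx ht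
      -- The new source is no farther from `v` than `x`, and `v` is at most half the cycle away from
      -- `u`: each level adds at most half of the cost.
      refine ⟨y, hy, v, hv, ?_⟩
      have h1 : N.scaledDist scale y v ≤ N.scaledDist scale x v := le_of_toLex_le hyx.le
      have h2 : 2 * N.scaledDist scale x v ≤ 2 * N.scaledDist scale x u + N.scaledCost scale c :=
        N.connected.two_mul_costDist_le (fun e => scale (N.weight e)) x c hu hv
      rw [Nat.add_mul i 1]
      omega
  obtain ⟨x, hx, -⟩ := key K le_rfl
  rw [hK] at hx
  exact hx

end Network

/-- The list is sorted by `f`. With `f` the distance and identifier it does not depend on the seeds,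
so these can be revealed along it. -/
theorem exists_list_prefix {V α : Type*} [Fintype V] [LinearOrder α] {f : V → α}
    (hf : Function.Injective f) :
    ∃ l : List V, l.Nodup ∧ ∀ x, ∃ l₁, l₁ <+: l ∧ ∀ y, y ∈ l₁ ↔ f y < f x := by
  classical
  let _ : LinearOrder V := LinearOrder.lift' f hf
  refine ⟨Finset.univ.sort (· ≤ ·), Finset.sort_nodup _ _, fun x => ?_⟩
  obtain ⟨l₁, l₂, hl⟩ := List.append_of_mem ((Finset.mem_sort (· ≤ ·)).mpr (Finset.mem_univ x))
  refine ⟨l₁, ⟨x :: l₂, hl.symm⟩, fun y => ?_⟩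
  have hs := Finset.pairwise_sort (Finset.univ : Finset V) (· ≤ ·)
  have hn := Finset.sort_nodup (Finset.univ : Finset V) (· ≤ ·)
  have hy := (Finset.mem_sort (· ≤ ·)).mpr (Finset.mem_univ y)
  rw [hl] at hs hn hy
  rw [List.pairwise_append] at hs
  rw [List.nodup_append] at hn
  constructor
  · intro h
    exact lt_of_le_of_ne (hs.2.2 y h x (by simp)) fun he => hn.2.2 y h x (by simp) (hf he)
  · intro h
    rcases List.mem_append.mp hy with h1 | h1
    · exact h1
    · rcases List.mem_cons.mp h1 with rfl | h1
      · exact absurd h (lt_irrefl _)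
      · exact absurd h (not_lt.mpr ((List.pairwise_cons.mp hs.2.1).1 y h1))

/-- If no element of level `B` precedes `x` although `t` elements of level `A` do, then the list of all
nodes by distance misses `B`. -/
theorem missesPrefix_of_le_precedence {V Ω : Type*} {A B : Set Ω} {ω : V → Ω} {dist ident : V → ℕ}
    [Finite V] {l : List V} {x : V} {t : ℕ}
    (hl : ∃ l₁, l₁ <+: l ∧ ∀ y, y ∈ l₁ ↔ toLex (dist y, ident y) < toLex (dist x, ident x))
    (ht : t ≤ precedence {y | ω y ∈ A} dist ident x)
    (hB : ¬ ∃ y, ω y ∈ B ∧ toLex (dist y, ident y) < toLex (dist x, ident x)) :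
    MissesPrefix A B l t ω := by
  obtain ⟨l₁, hl₁, hmem⟩ := hl
  refine ⟨l₁, hl₁, fun v hv hvB => hB ⟨v, hvB, (hmem v).mp hv⟩,
    (Set.toFinite {y | ω y ∈ A ∧ toLex (dist y, ident y) < toLex (dist x, ident x)}).toFinset,
    ?_, fun v hv => ?_⟩
  · rw [← Set.ncard_eq_toFinset_card]
    exact ht
  · rw [Set.Finite.mem_toFinset] at hv
    exact ⟨(hmem v).mpr hv.2, hv.1⟩

/-! ### Random levels and the failure probability of one scale. -/

/-- The uniform distribution on the unit interval. -/
noncomputable abbrev uniformLaw : Measure ℝ := volume.restrict (Set.Icc 0 1)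

instance isProbabilityMeasure_uniformLaw : IsProbabilityMeasure uniformLaw :=
  ⟨by simp⟩

/-- A uniform seed reaches level `i` with probability `p ^ i`. -/
def levelSet (p : ℝ) (i : ℕ) : Set ℝ := if i = 0 then Set.univ else Set.Iio (p ^ i)

theorem measurableSet_levelSet (p : ℝ) (i : ℕ) : MeasurableSet (levelSet p i) := by
  rw [levelSet]
  split_ifs
  · exact MeasurableSet.univ
  · exact measurableSet_Iio

theorem uniformLaw_levelSet {p : ℝ} (h0 : 0 ≤ p) (h1 : p ≤ 1) (i : ℕ) :
    uniformLaw (levelSet p i) = ENNReal.ofReal (p ^ i) := by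
  rw [levelSet]
  split_ifs with hi
  · simp [hi]
  · rw [Measure.restrict_apply measurableSet_Iio]
    have : Set.Iio (p ^ i) ∩ Set.Icc 0 1 = Set.Ico 0 (p ^ i) := by
      have := pow_le_one₀ h0 h1 (n := i)
      ext x
      simp only [Set.mem_inter_iff, Set.mem_Iio, Set.mem_Icc, Set.mem_Ico]
      constructor
      · rintro ⟨h2, h3, -⟩
        exact ⟨h3, h2⟩
      · rintro ⟨h2, h3⟩
        exact ⟨h3, h2, h3.le.trans this⟩
    rw [this, Real.volume_Ico, sub_zero]

theorem levelSet_succ_subset {p : ℝ} (h0 : 0 ≤ p) (h1 : p ≤ 1) (i : ℕ) :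
    levelSet p (i + 1) ⊆ levelSet p i := by
  intro x hx
  rw [levelSet, if_neg (by simp)] at hx
  rw [levelSet]
  split_ifs
  · trivial
  · exact lt_of_lt_of_le hx (pow_le_pow_of_le_one h0 h1 i.le_succ)

theorem uniformLaw_levelSet_diff {p : ℝ} (h0 : 0 ≤ p) (h1 : p ≤ 1) (i : ℕ) :
    uniformLaw (levelSet p i \ levelSet p (i + 1)) =
      ENNReal.ofReal (1 - p) * uniformLaw (levelSet p i) := by
  rw [measure_sdiff (levelSet_succ_subset h0 h1 i) (measurableSet_levelSet p _).nullMeasurableSet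
    (measure_ne_top _ _), uniformLaw_levelSet h0 h1, uniformLaw_levelSet h0 h1,
    ← ENNReal.ofReal_sub _ (pow_nonneg h0 _), ← ENNReal.ofReal_mul (by linarith)]
  congr 1
  ring

namespace Network

variable {n : ℕ} {N : Network n}

/-- With high probability, the instances of a scale recognize a cheap cycle. -/
theorem pi_not_exists_cycleEstimate_le {P : Plan ℝ} {p : ℝ} (h0 : 0 ≤ p) (h1 : p ≤ 1)
    {s K t : ℕ} {scale : ℕ → ℕ} {value : ℕ → ℕ} (hs : ∀ ω, 1 ≤ ω → 1 ≤ scale ω)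
    (hinst : ∀ i < K, s * K + i < P.instances)
    (hscale : ∀ i < K, P.scale (s * K + i) = scale) (hvalue : ∀ i < K, P.value (s * K + i) = value)
    (hsrc : ∀ i < K, P.sources (s * K + i) = levelSet p i)
    {a : Fin n} {c : N.graph.Walk a a} (hc : c.IsCycle)
    (hT : K * N.scaledCost scale c + 2 * t ≤ 2 * P.duration) :
    Measure.pi (fun _ : Fin n => uniformLaw) {ω | ¬ ∃ v X, X ≤ K * N.scaledCost scale c ∧
      N.cycleEstimate P ω v ≤ value X} ≤
    ENNReal.ofReal (K * (n * (1 - p) ^ t) + n * p ^ K) := by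
  have hkey : ∀ v, Function.Injective fun x => toLex (N.scaledDist scale x v, N.ident x) :=
    fun v x y h => N.ident_injective (Prod.mk.inj (toLex.injective h)).2
  choose l hl hpre using fun v => exists_list_prefix (hkey v)
  -- Failure has two causes: at some node, `t` sources of a level come before the first one of the
  -- next level, or some node reaches level `K`.
  have hsub : {ω : Fin n → ℝ | ¬ ∃ v X, X ≤ K * N.scaledCost scale c ∧
      N.cycleEstimate P ω v ≤ value X} ⊆
      (⋃ i ∈ Finset.range K, ⋃ v ∈ Finset.univ,
        {ω | MissesPrefix (levelSet p i) (levelSet p (i + 1)) (l v) t ω}) ∪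
      ⋃ v ∈ Finset.univ, {ω | ω v ∈ levelSet p K} := by
    intro ω hω
    by_contra hcon
    simp only [Set.mem_union, Set.mem_iUnion, Finset.mem_range, Finset.mem_univ, exists_prop,
      true_and, not_or, not_exists, not_and, Set.mem_ofPred_eq] at hcon
    obtain ⟨hmiss, htop⟩ := hcon
    obtain ⟨i, hi, x, hx, u, hu, hux, hprec⟩ := exists_level (N := N) (scale := scale)
      (S := fun i => {x | ω x ∈ levelSet p i}) (K := K) (t := t)
      -- Level 0 is `Set.univ` by definition, not `Set.Iio 1`, so it contains every node for every
      -- choice of seeds.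
      (by simp [levelSet]) (Set.eq_empty_of_forall_notMem htop) (fun i hi v x _ ht => by
        by_contra hB
        exact hmiss i hi v (missesPrefix_of_le_precedence (hpre v x) ht hB)) c
    have hsrc' : sourceSet P ω (s * K + i) = {x | ω x ∈ levelSet p i} := by
      rw [sourceSet, hsrc i hi]
    have hle : (i + 1) * N.scaledCost scale c ≤ K * N.scaledCost scale c :=
      Nat.mul_le_mul_right _ hi
    rw [Nat.add_mul i 1] at hle
    have hdet : ∀ v ∈ c.support, N.scaledDist (P.scale (s * K + i)) x v +
        precedence (sourceSet P ω (s * K + i))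
          (fun x => N.scaledDist (P.scale (s * K + i)) x v) N.ident x < P.duration := by
      intro v hv
      rw [hsrc', hscale i hi]
      have h2 := hprec v hv
      have h3 : 2 * N.scaledDist scale x v ≤ 2 * N.scaledDist scale x u + N.scaledCost scale c :=
        N.connected.two_mul_costDist_le (fun e => scale (N.weight e)) x c hu hv
      omega
    obtain ⟨v, X, hX, hv⟩ := exists_cycleEstimate_le (hinst i hi) (by rw [hsrc']; exact hx) hc hdet
      (by rwa [hscale i hi]) hu
    rw [hscale i hi] at hX
    rw [hvalue i hi] at hv
    exact hω ⟨v, X, by omega, hv⟩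
  refine (measure_mono hsub).trans ((measure_union_le _ _).trans ?_)
  have h2 : 0 ≤ 1 - p := by linarith
  rw [ENNReal.ofReal_add (by positivity) (by positivity)]
  gcongr
  · refine (measure_biUnion_finset_le _ _).trans ?_
    calc _ ≤ ∑ i ∈ Finset.range K, ∑ v : Fin n, ENNReal.ofReal (1 - p) ^ t :=
          Finset.sum_le_sum fun i _ => (measure_biUnion_finset_le _ _).trans
            (Finset.sum_le_sum fun v _ => pi_missesPrefix_le (measurableSet_levelSet p i)
              (measurableSet_levelSet p (i + 1)) (uniformLaw_levelSet_diff h0 h1 i).le (hl v) t)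
      _ = ENNReal.ofReal (K * (n * (1 - p) ^ t)) := by
          rw [ENNReal.ofReal_mul (by positivity), ENNReal.ofReal_mul (by positivity),
            ENNReal.ofReal_pow h2]
          simp
  · refine (measure_biUnion_finset_le _ _).trans ?_
    have h3 : ∀ v : Fin n, Measure.pi (fun _ : Fin n => uniformLaw) {ω | ω v ∈ levelSet p K} =
        ENNReal.ofReal (p ^ K) := fun v => by
      rw [← uniformLaw_levelSet h0 h1]
      exact (measurePreserving_eval (fun _ : Fin n => uniformLaw) v).measure_preimage
        (measurableSet_levelSet p K).nullMeasurableSet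
    rw [Finset.sum_congr rfl fun v _ => h3 v, ENNReal.ofReal_mul (by positivity)]
    simp

end Network

/-! ### Choice of the parameters and numerical estimates. -/

open Real

/-- The number of levels. -/
noncomputable def levelCount (n : ℕ) (k : ℝ) : ℕ := ⌈min k (log n) - 1 / (2 * log n)⌉₊

/-- The probability to reach the next level. -/
noncomputable def levelProb (n : ℕ) (k : ℝ) : ℝ := (n : ℝ) ^ (-(1 / (levelCount n k : ℝ))) / log n

/-- The number of sources that every node keeps track of. -/
noncomputable def listSize (n : ℕ) (k : ℝ) : ℕ := ⌈4 * log n / levelProb n k⌉₊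

/-- The relative rounding error. -/
noncomputable def roundingError (n : ℕ) : ℝ := 1 / (8 * log n ^ 2)

/-- The bound on the number of hops of the minimum weight cycle. -/
noncomputable def hopBound (n : ℕ) (α : ℝ) : ℝ := 10 * n * log n / α

/-- The unit of the weights of scale `s`. -/
noncomputable def scaleUnit (n : ℕ) (α : ℝ) (s : ℕ) : ℝ := roundingError n * 2 ^ s / hopBound n α

/-- The bound on the weight of a cycle. -/
def cycleCap (A a n : ℕ) : ℕ := n * (A * n ^ a)

/-- The parameters of the algorithm. -/
noncomputable def cyclePlan (A a : ℕ) (k : ℝ) (n : ℕ) (α : ℝ) : Plan ℝ where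
  -- At the right scale the cycle has rescaled cost at most 2h/ε, and the source is within half of K
  -- times that; the list size pays for the pipelining delay.
  duration := ⌈levelCount n k * hopBound n α / roundingError n⌉₊ + listSize n k
  -- Instance s * K + i combines scale `s` with level `i`; the scales reach the largest possible
  -- cycle weight.
  instances := (Nat.clog 2 (cycleCap A a n) + 1) * levelCount n k
  modulus := A * n ^ a + 1
  cap := cycleCap A a n
  scale ι ω := ⌈ω / scaleUnit n α (ι / levelCount n k)⌉₊
  value ι X := ⌊scaleUnit n α (ι / levelCount n k) * X⌋₊
  sources ι := levelSet (levelProb n k) (ι % levelCount n k)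

theorem one_le_log_of_three_le {n : ℕ} (hn : 3 ≤ n) : 1 ≤ log n := by
  rw [Real.le_log_iff_exp_le (by positivity)]
  have h1 : (3 : ℝ) ≤ n := by exact_mod_cast hn
  linarith [Real.exp_one_lt_d9]

section

variable {n : ℕ} {k α : ℝ}

theorem log_le_natCast (n : ℕ) : log n ≤ n := (Real.log_le_self (Nat.cast_nonneg n))

theorem levelCount_pos (hn : 3 ≤ n) (hk : 1 ≤ k) : 0 < levelCount n k := by
  have hL := one_le_log_of_three_le hn
  rw [levelCount, Nat.ceil_pos, sub_pos]
  refine lt_of_lt_of_le ?_ (le_min hk hL)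
  rw [div_lt_one (by positivity)]
  linarith

theorem levelCount_le (hn : 3 ≤ n) (hk : 1 ≤ k) :
    (levelCount n k : ℝ) ≤ min k (log n) - 1 / (2 * log n) + 1 := by
  have hL := one_le_log_of_three_le hn
  refine (Nat.ceil_lt_add_one ?_).le
  rw [sub_nonneg]
  refine le_trans ?_ (le_min hk hL)
  rw [div_le_one (by positivity)]
  linarith

theorem levelCount_le_two_mul_log (hn : 3 ≤ n) (hk : 1 ≤ k) :
    (levelCount n k : ℝ) ≤ 2 * log n := by
  have hL := one_le_log_of_three_le hn
  have h1 := levelCount_le hn hk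
  have h2 : 0 ≤ 1 / (2 * log n) := by positivity
  linarith [min_le_right k (log n)]

/-- A plain ceiling of `k` can come arbitrarily close to k + 1. Subtracting 1/(2 log n) first leaves
exactly the slack that the rounding error uses, as K ≤ 2 log n. -/
theorem levelCount_mul_le (hn : 3 ≤ n) (hk : 1 ≤ k) :
    levelCount n k * (1 + 2 * roundingError n) ≤ k + 1 := by
  have hL := one_le_log_of_three_le hn
  have h1 := levelCount_le hn hk
  have h2 := levelCount_le_two_mul_log hn hk
  have h3 : levelCount n k * (2 * roundingError n) ≤ 1 / (2 * log n) := by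
    calc levelCount n k * (2 * roundingError n) ≤ 2 * log n * (2 * roundingError n) := by
          gcongr
          rw [roundingError]
          positivity
      _ = 1 / (2 * log n) := by
          rw [roundingError]
          field_simp
          norm_num
  linarith [min_le_left k (log n)]

/-- Capping `k` at log n and subtracting 1/(2 log n) each raise the exponent by at most 1/log n, and
n^(2/log n) = e^2. -/
theorem rpow_inv_levelCount_le (hn : 3 ≤ n) (hk : 1 ≤ k) :
    (n : ℝ) ^ (1 / (levelCount n k : ℝ)) ≤ exp 2 * (n : ℝ) ^ (1 / k) := by
  have hL := one_le_log_of_three_le hn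
  have hn0 : (0 : ℝ) < n := by positivity
  have hK : (1 : ℝ) ≤ levelCount n k := by exact_mod_cast levelCount_pos hn hk
  set m := min k (log n) with hm
  have hm1 : 1 ≤ m := le_min hk hL
  have h1 : m - 1 / (2 * log n) ≤ levelCount n k := Nat.le_ceil _
  have h2 : 1 / (levelCount n k : ℝ) ≤ 1 / m + 1 / log n := by
    have h3 : 1 / (levelCount n k : ℝ) - 1 / m ≤ 1 / log n := by
      rw [div_sub_div _ _ (by positivity) (by positivity)]
      have h4 : 1 / (2 * log n) ≤ 1 / log n := by
        apply one_div_le_one_div_of_le <;> linarith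
      have h5 : 0 ≤ 1 / log n := by positivity
      have h6 : 1 ≤ (levelCount n k : ℝ) * m := one_le_mul_of_one_le_of_one_le hK hm1
      rw [div_le_iff₀ (by positivity)]
      nlinarith
    linarith
  have h3 : 1 / m ≤ 1 / k + 1 / log n := by
    have h5 : 0 ≤ 1 / log n := by positivity
    have h6 : 0 ≤ 1 / k := by positivity
    rcases min_choice k (log n) with h | h <;> rw [hm, h] <;> linarith
  calc (n : ℝ) ^ (1 / (levelCount n k : ℝ)) ≤ (n : ℝ) ^ (2 / log n + 1 / k) := by
        refine Real.rpow_le_rpow_of_exponent_le (by exact_mod_cast (by omega : 1 ≤ n)) ?_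
        have : 2 / log n = 1 / log n + 1 / log n := by ring
        linarith
    _ = exp 2 * (n : ℝ) ^ (1 / k) := by
        rw [Real.rpow_add hn0, Real.rpow_def_of_pos hn0 (2 / log n)]
        congr 2
        field_simp

theorem levelProb_pos (hn : 3 ≤ n) : 0 < levelProb n k := by
  have hL := one_le_log_of_three_le hn
  have hn0 : (0 : ℝ) < n := by positivity
  rw [levelProb]
  positivity

theorem levelProb_le_one (hn : 3 ≤ n) : levelProb n k ≤ 1 := by
  have hL := one_le_log_of_three_le hn
  rw [levelProb, div_le_one (by positivity)]
  refine le_trans (Real.rpow_le_one_of_one_le_of_nonpos (by exact_mod_cast (by omega : 1 ≤ n)) ?_) hL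
  rw [neg_nonpos]
  positivity

/-- The extra divisor log n in `levelProb` is there for this bound: n p^K = (log n)^(-K), with K ≥
1. -/
theorem mul_levelProb_pow_le (hn : 3 ≤ n) (hk : 1 ≤ k) :
    n * levelProb n k ^ levelCount n k ≤ 1 / log n := by
  have hL := one_le_log_of_three_le hn
  have hn0 : (0 : ℝ) < n := by positivity
  have hK := levelCount_pos hn hk
  have hK' : (levelCount n k : ℝ) ≠ 0 := by exact_mod_cast hK.ne'
  rw [levelProb, div_pow, ← Real.rpow_natCast, ← Real.rpow_mul hn0.le]
  have : -(1 / (levelCount n k : ℝ)) * levelCount n k = -1 := by field_simp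
  rw [this, Real.rpow_neg_one, mul_div_assoc', mul_inv_cancel₀ hn0.ne']
  exact one_div_le_one_div_of_le (by positivity) (le_self_pow₀ hL hK.ne')

/-- (1-p)^t ≤ e^(-pt) and pt ≥ 4 log n; the fourth power survives a union over all levels and nodes.
-/
theorem one_sub_levelProb_pow_le (hn : 3 ≤ n) :
    (1 - levelProb n k) ^ listSize n k ≤ 1 / (n : ℝ) ^ 4 := by
  have hL := one_le_log_of_three_le hn
  have hn0 : (0 : ℝ) < n := by positivity
  have hp := levelProb_pos (k := k) hn
  have hp1 := levelProb_le_one (k := k) hn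
  have h1 : 4 * log n ≤ listSize n k * levelProb n k := by
    rw [← div_le_iff₀ hp]
    exact Nat.le_ceil _
  calc (1 - levelProb n k) ^ listSize n k ≤ exp (-levelProb n k) ^ listSize n k := by
        gcongr
        exact Real.one_sub_le_exp_neg _
    _ = exp (-(listSize n k * levelProb n k)) := by
        rw [← Real.exp_nat_mul]
        ring_nf
    _ ≤ exp (-(4 * log n)) := by
        gcongr
    _ = 1 / (n : ℝ) ^ 4 := by
        rw [Real.exp_neg, one_div, show (4 : ℝ) * log n = (4 : ℕ) * log n by norm_num,
          Real.exp_nat_mul, Real.exp_log hn0]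

theorem failure_probability_le (hn : 3 ≤ n) (hk : 1 ≤ k) :
    levelCount n k * (n * (1 - levelProb n k) ^ listSize n k) +
      n * levelProb n k ^ levelCount n k ≤ 2 / n + 1 / log n := by
  have hn1 : (1 : ℝ) ≤ n := by exact_mod_cast (by omega : 1 ≤ n)
  have hn0 : (0 : ℝ) < n := by positivity
  have h1 : levelCount n k * (n * (1 - levelProb n k) ^ listSize n k) ≤ 2 / n := by
    have h2 := (levelCount_le_two_mul_log hn hk).trans
      (mul_le_mul_of_nonneg_left (log_le_natCast n) zero_le_two)
    have h3 := one_sub_levelProb_pow_le (k := k) hn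
    have h4 : 0 ≤ 1 - levelProb n k := sub_nonneg.mpr (levelProb_le_one hn)
    calc _ ≤ 2 * n * (n * (1 / (n : ℝ) ^ 4)) := by
          gcongr
      _ = 2 / (n : ℝ) ^ 2 := by field_simp
      _ ≤ 2 / n := by
          gcongr
          exact le_self_pow₀ hn1 two_ne_zero
  linarith [mul_levelProb_pow_le hn hk]

theorem listSize_le (hn : 3 ≤ n) (hk : 1 ≤ k) :
    (listSize n k : ℝ) ≤ 33 * log n ^ 2 * (n : ℝ) ^ (1 / k) := by
  have hL := one_le_log_of_three_le hn
  have hn0 : (0 : ℝ) < n := by positivity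
  have hn1 : (1 : ℝ) ≤ n := by exact_mod_cast (by omega : 1 ≤ n)
  have hp := levelProb_pos (k := k) hn
  have h1 : 4 * log n / levelProb n k ≤ 32 * log n ^ 2 * (n : ℝ) ^ (1 / k) := by
    have h2 := rpow_inv_levelCount_le hn hk
    have h3 : exp 2 ≤ 8 := by
      have : exp 2 = exp 1 ^ 2 := by rw [← Real.exp_nat_mul]; norm_num
      rw [this]
      nlinarith [Real.exp_one_lt_d9, Real.exp_pos 1]
    calc 4 * log n / levelProb n k = 4 * log n ^ 2 * (n : ℝ) ^ (1 / (levelCount n k : ℝ)) := by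
          rw [levelProb, Real.rpow_neg hn0.le]
          field_simp
      _ ≤ 4 * log n ^ 2 * (8 * (n : ℝ) ^ (1 / k)) := by
          gcongr
          exact h2.trans (by gcongr)
      _ = 32 * log n ^ 2 * (n : ℝ) ^ (1 / k) := by ring
  have h4 : 1 ≤ log n ^ 2 * (n : ℝ) ^ (1 / k) :=
    one_le_mul_of_one_le_of_one_le (one_le_pow₀ hL) (Real.one_le_rpow hn1 (by positivity))
  have h5 := (Nat.ceil_lt_add_one (a := 4 * log n / levelProb n k) (by positivity)).le
  rw [listSize]
  linarith

/-- 160 = 2 · 10 · 8, from the number of levels, the hop bound and 1/ε; the list size and the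
ceiling fit into the other summand. -/
theorem duration_le (A a : ℕ) (hn : 3 ≤ n) (hk : 1 ≤ k) (hα : 0 < α) :
    ((cyclePlan A a k n α).duration : ℝ) ≤
      160 * log n ^ 4 * ((n : ℝ) ^ (1 / k) + n / α) := by
  have hL := one_le_log_of_three_le hn
  have hn1 : (1 : ℝ) ≤ n := by exact_mod_cast (by omega : 1 ≤ n)
  have h1 := listSize_le hn hk
  have h2 := levelCount_le_two_mul_log hn hk
  have h3 : levelCount n k * hopBound n α / roundingError n ≤ 160 * log n ^ 4 * (n / α) := by
    calc levelCount n k * hopBound n α / roundingError n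
        ≤ 2 * log n * hopBound n α / roundingError n := by
          gcongr
          · rw [roundingError]; positivity
          · rw [hopBound]; positivity
      _ = 160 * log n ^ 4 * (n / α) := by
          rw [hopBound, roundingError]
          field_simp
          norm_num
  have h4 := (Nat.ceil_lt_add_one (a := levelCount n k * hopBound n α / roundingError n)
    (by rw [hopBound, roundingError]; positivity)).le
  have h5 : (1 : ℝ) ≤ (n : ℝ) ^ (1 / k) := Real.one_le_rpow hn1 (by positivity)
  have h6 : log n ^ 2 ≤ log n ^ 4 := pow_le_pow_right₀ hL (by norm_num)
  have h7 : 1 ≤ log n ^ 4 * (n : ℝ) ^ (1 / k) := one_le_mul_of_one_le_of_one_le (one_le_pow₀ hL) h5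
  have h8 : log n ^ 2 * (n : ℝ) ^ (1 / k) ≤ log n ^ 4 * (n : ℝ) ^ (1 / k) := by gcongr
  rw [cyclePlan]
  push_cast
  nlinarith

theorem clog_cycleCap_le (A a : ℕ) (hn : 3 ≤ n) :
    (Nat.clog 2 (cycleCap A a n) : ℝ) ≤ A + (a + 1) * (3 * log n) := by
  have hL := one_le_log_of_three_le hn
  have h1 : (Nat.clog 2 n : ℝ) ≤ 3 * log n := by
    have hpos : 0 < Nat.clog 2 n := Nat.clog_pos (by simp) (by omega)
    obtain ⟨c, hc⟩ := Nat.exists_eq_add_of_le' hpos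
    have h2 := Nat.pow_pred_clog_lt_self (b := 2) (x := n) (by simp) (by omega)
    rw [hc] at h2 ⊢
    have h3 : (2 : ℝ) ^ c ≤ n := by exact_mod_cast h2.le
    have h4 := Real.log_le_log (by positivity) h3
    rw [Real.log_pow] at h4
    push_cast
    nlinarith [Real.log_two_gt_d9, Nat.cast_nonneg (α := ℝ) c]
  have h2 : Nat.clog 2 (cycleCap A a n) ≤ A + (a + 1) * Nat.clog 2 n := by
    rw [Nat.clog_le_iff_le_pow (by simp), pow_add, mul_comm (a + 1), pow_mul, cycleCap]
    calc n * (A * n ^ a) = A * n ^ (a + 1) := by ring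
      _ ≤ 2 ^ A * (2 ^ Nat.clog 2 n) ^ (a + 1) :=
        Nat.mul_le_mul Nat.lt_two_pow_self.le
          (Nat.pow_le_pow_left (Nat.le_pow_clog (by simp) n) _)
  have h3 : (Nat.clog 2 (cycleCap A a n) : ℝ) ≤ A + (a + 1) * Nat.clog 2 n := by exact_mod_cast h2
  refine h3.trans ?_
  gcongr

/-- Scales and levels contribute one logarithm each to the fourth power in the duration; 24 pays for
the flooding. -/
theorem rounds_le (A a D : ℕ) (hn : 3 ≤ n) (hk : 1 ≤ k) (hα : 0 < α) :
    (((cyclePlan A a k n α).detectionTime + 16 * D + 8 : ℕ) : ℝ) ≤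
      (320 * (A + 3 * a + 4) + 24) * log n ^ 6 * ((n : ℝ) ^ (1 / k) + n / α + D) := by
  have hL := one_le_log_of_three_le hn
  have hn1 : (1 : ℝ) ≤ n := by exact_mod_cast (by omega : 1 ≤ n)
  have h1 := duration_le A a hn hk hα
  have h2 : ((cyclePlan A a k n α).instances : ℝ) ≤ (A + 3 * a + 4) * log n * (2 * log n) := by
    have h3 := clog_cycleCap_le (n := n) A a hn
    rw [cyclePlan]
    push_cast
    gcongr
    · nlinarith [Nat.cast_nonneg (α := ℝ) A]
    · exact levelCount_le_two_mul_log hn hk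
  have h5 : (1 : ℝ) ≤ (n : ℝ) ^ (1 / k) := Real.one_le_rpow hn1 (by positivity)
  have h6 : 0 ≤ n / α := by positivity
  have hD := Nat.cast_nonneg (α := ℝ) D
  set Z := (n : ℝ) ^ (1 / k) + n / α + D with hZ
  have h7 : ((cyclePlan A a k n α).instances : ℝ) * (cyclePlan A a k n α).duration ≤
      (A + 3 * a + 4) * log n * (2 * log n) * (160 * log n ^ 4 * Z) := by
    gcongr
    refine h1.trans ?_
    gcongr
    linarith
  have h8 : 16 * (D : ℝ) + 8 ≤ 24 * (log n ^ 6 * Z) := by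
    have h9 : Z ≤ log n ^ 6 * Z := le_mul_of_one_le_left (by linarith) (one_le_pow₀ hL)
    linarith
  rw [Plan.detectionTime]
  push_cast
  calc _ ≤ (A + 3 * a + 4) * log n * (2 * log n) * (160 * log n ^ 4 * Z) +
        24 * (log n ^ 6 * Z) := by linarith
    _ = _ := by ring

theorem pow_le_two_pow_mul_clog (B n : ℕ) : n ^ B ≤ 2 ^ (B * Nat.clog 2 n) := by
  rw [mul_comm, pow_mul]
  exact Nat.pow_le_pow_left (Nat.le_pow_clog (by simp) n) B

theorem mul_pow_add_one_le (A a : ℕ) (hn : 3 ≤ n) : A * n ^ a + 1 ≤ n ^ (A + a) := by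
  have h1 : A + 1 ≤ n ^ A := Nat.succ_le_of_lt (Nat.lt_pow_self (by omega))
  have h2 : 1 ≤ n ^ a := Nat.one_le_pow _ _ (by omega)
  calc A * n ^ a + 1 ≤ (A + 1) * n ^ a := by rw [Nat.add_mul]; omega
    _ ≤ n ^ A * n ^ a := Nat.mul_le_mul_right _ h1
    _ = n ^ (A + a) := (pow_add _ _ _).symm

theorem duration_le_pow (A a : ℕ) (hn : 3 ≤ n) (hk : 1 ≤ k) (hα : 1 ≤ α) :
    (cyclePlan A a k n α).duration ≤ n ^ 11 := by
  have hn3 : (3 : ℝ) ≤ n := by exact_mod_cast hn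
  have hL := one_le_log_of_three_le hn
  have h1 := duration_le (α := α) A a hn hk (by linarith)
  have h2 : (n : ℝ) ^ (1 / k) ≤ n := by
    conv_rhs => rw [← Real.rpow_one (n : ℝ)]
    exact Real.rpow_le_rpow_of_exponent_le (by linarith) ((div_le_one (by linarith)).mpr hk)
  have h3 : n / α ≤ n := div_le_self (by linarith) hα
  have h4 : ((cyclePlan A a k n α).duration : ℝ) ≤ (n : ℝ) ^ 11 := by
    calc _ ≤ 160 * log n ^ 4 * ((n : ℝ) ^ (1 / k) + n / α) := h1
      _ ≤ 160 * (n : ℝ) ^ 4 * (n + n) := by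
          gcongr
          exact log_le_natCast n
      _ = 320 * (n : ℝ) ^ 5 := by ring
      _ ≤ 3 ^ 6 * (n : ℝ) ^ 5 := by gcongr; norm_num
      _ ≤ (n : ℝ) ^ 6 * (n : ℝ) ^ 5 := by gcongr
      _ = (n : ℝ) ^ 11 := by ring
  exact_mod_cast h4

/-- Distance and identifier are below n^(11 + A + a), and pairing at most squares this; hence the
exponent. -/
theorem pair_lt_two_pow (A a : ℕ) (hn : 3 ≤ n) (hk : 1 ≤ k) (hα : 1 ≤ α) {d i : ℕ}
    (hd : d < (cyclePlan A a k n α).duration) (hi : i ≤ A * n ^ a) :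
    Nat.pair d i < 2 ^ ((22 + 2 * (A + a)) * Nat.clog 2 n) := by
  refine lt_of_lt_of_le (Nat.pair_lt_max_add_one_sq d i)
    (le_trans ?_ (pow_le_two_pow_mul_clog _ n))
  have h1 := duration_le_pow A a hn hk hα
  have h2 := mul_pow_add_one_le A a hn
  have h3 : n ^ 11 ≤ n ^ (11 + (A + a)) := Nat.pow_le_pow_right (by omega) (by omega)
  have h4 : n ^ (A + a) ≤ n ^ (11 + (A + a)) := Nat.pow_le_pow_right (by omega) (by omega)
  have h5 : max d i + 1 ≤ n ^ (11 + (A + a)) := by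
    rcases max_cases d i with ⟨h, -⟩ | ⟨h, -⟩ <;> rw [h] <;> omega
  calc (max d i + 1) ^ 2 ≤ (n ^ (11 + (A + a))) ^ 2 := Nat.pow_le_pow_left h5 2
    _ = n ^ (22 + 2 * (A + a)) := by rw [← pow_mul]; congr 1; ring

theorem cap_mul_modulus_le (A a : ℕ) (hn : 3 ≤ n) :
    cycleCap A a n * (A * n ^ a + 1) + (A * n ^ a + 1) ≤
      2 ^ ((22 + 2 * (A + a)) * Nat.clog 2 n) := by
  refine le_trans ?_ (pow_le_two_pow_mul_clog _ n)
  have h1 := mul_pow_add_one_le A (a + 1) hn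
  have h2 := mul_pow_add_one_le A a hn
  calc cycleCap A a n * (A * n ^ a + 1) + (A * n ^ a + 1)
      = (A * n ^ (a + 1) + 1) * (A * n ^ a + 1) := by rw [cycleCap]; ring
    _ ≤ n ^ (A + (a + 1)) * n ^ (A + a) := Nat.mul_le_mul h1 h2
    _ = n ^ (A + (a + 1) + (A + a)) := (pow_add _ _ _).symm
    _ ≤ n ^ (22 + 2 * (A + a)) := Nat.pow_le_pow_right (by omega) (by omega)

end

theorem tendsto_failure_probability :
    Filter.Tendsto (fun n : ℕ => ENNReal.ofReal (2 / n + 1 / log n)) Filter.atTop (nhds 0) := by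
  rw [← ENNReal.ofReal_zero, ← add_zero (0 : ℝ)]
  refine (ENNReal.continuous_ofReal.tendsto _).comp (Filter.Tendsto.add ?_ ?_)
  · exact tendsto_const_div_atTop_nhds_zero_nat 2
  · simp only [one_div]
    exact (Real.tendsto_log_atTop.comp tendsto_natCast_atTop_atTop).inv_tendsto_atTop

/-! ### Rounding of weights and the approximation guarantee. -/

namespace Network

variable {n : ℕ} {N : Network n} {A a : ℕ} {k α : ℝ}

theorem one_le_cycleWeight {v : Fin n} {c : N.graph.Walk v v} (hc : c.IsCycle) :
    1 ≤ N.cycleWeight c := by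
  cases c with
  | nil => exact absurd hc (by simp)
  | cons h p =>
    have := N.one_le_weight _ ((SimpleGraph.mem_edgeSet _).mpr h)
    simp only [cycleWeight, SimpleGraph.Walk.edges_cons, List.map_cons, List.sum_cons]
    omega

theorem length_le_card {v : Fin n} {c : N.graph.Walk v v} (hc : c.IsCycle) : c.length ≤ n := by
  have h := hc.support_nodup.length_le_card
  rwa [List.length_tail, SimpleGraph.Walk.length_support, Nat.add_sub_cancel, Fintype.card_fin] at h

theorem cycleWeight_le_cap (hN : N.PolyBounded A a) {v : Fin n} {c : N.graph.Walk v v}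
    (hc : c.IsCycle) : N.cycleWeight c ≤ cycleCap A a n := by
  have h := List.sum_le_card_nsmul (c.edges.map N.weight) (A * n ^ a) (by
    intro x hx
    obtain ⟨e, he, rfl⟩ := List.mem_map.mp hx
    exact hN.1 e (c.edges_subset_edgeSet he))
  rw [List.length_map, SimpleGraph.Walk.length_edges, smul_eq_mul] at h
  exact h.trans (Nat.mul_le_mul_right _ (length_le_card hc))

theorem cycleWeight_le_scaledCost {μ : ℝ} (hμ : 0 < μ) {v : Fin n} (c : N.graph.Walk v v) :
    (N.cycleWeight c : ℝ) ≤ μ * N.scaledCost (fun ω => ⌈ω / μ⌉₊) c := by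
  rw [cycleWeight, scaledCost, SimpleGraph.Walk.cost]
  induction c.edges with
  | nil => simp
  | cons e l ih =>
    have h1 : (N.weight e : ℝ) ≤ μ * ⌈N.weight e / μ⌉₊ := by
      rw [mul_comm, ← div_le_iff₀ hμ]
      exact Nat.le_ceil _
    rw [List.map_cons, List.sum_cons, List.map_cons, List.sum_cons, Nat.cast_add, Nat.cast_add]
    linarith

theorem scaledCost_le {μ : ℝ} (hμ : 0 < μ) {v : Fin n} (c : N.graph.Walk v v) :
    μ * N.scaledCost (fun ω => ⌈ω / μ⌉₊) c ≤ N.cycleWeight c + μ * c.length := by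
  rw [cycleWeight, scaledCost, SimpleGraph.Walk.cost, ← SimpleGraph.Walk.length_edges]
  induction c.edges with
  | nil => simp
  | cons e l ih =>
    have h1 : μ * ⌈N.weight e / μ⌉₊ ≤ N.weight e + μ := by
      have := (Nat.ceil_lt_add_one (a := N.weight e / μ) (by positivity)).le
      calc μ * ⌈N.weight e / μ⌉₊ ≤ μ * (N.weight e / μ + 1) := by gcongr
        _ = N.weight e + μ := by field_simp
    rw [List.map_cons, List.sum_cons, List.map_cons, List.sum_cons, List.length_cons, Nat.cast_add,
      Nat.cast_add, Nat.cast_succ]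
    linarith

theorem scaleUnit_pos (hn : 3 ≤ n) (hα : 0 < α) (s : ℕ) : 0 < scaleUnit n α s := by
  have hL := one_le_log_of_three_le hn
  have hn0 : (0 : ℝ) < n := by positivity
  rw [scaleUnit, roundingError, hopBound]
  positivity

theorem one_le_scale (hn : 3 ≤ n) (hα : 0 < α) (ι ω : ℕ) (hω : 1 ≤ ω) :
    1 ≤ (cyclePlan A a k n α).scale ι ω := by
  have h := scaleUnit_pos hn hα (ι / levelCount n k)
  have hω' : (0 : ℝ) < ω := by exact_mod_cast hω
  exact Nat.ceil_pos.mpr (by positivity)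

/-- All estimates are sound. -/
theorem cycleWeight_le_cycleEstimate (hn : 3 ≤ n) (hα : 0 < α) (hN : N.PolyBounded A a)
    {v₀ : Fin n} {c : N.graph.Walk v₀ v₀} (hc : N.IsMinWeightCycle c) (ω : Fin n → ℝ) (v : Fin n) :
    N.cycleWeight c ≤ N.cycleEstimate (cyclePlan A a k n α) ω v := by
  refine le_cycleEstimate (one_le_scale hn hα) (cycleWeight_le_cap hN hc.1)
    (fun ι X z q hq hX => ?_) v
  have hμ := scaleUnit_pos hn hα (ι / levelCount n k)
  -- True weights are integers, so rounding the value down keeps it above the minimum weight.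
  refine Nat.le_floor ?_
  calc (N.cycleWeight c : ℝ) ≤ N.cycleWeight q := by exact_mod_cast hc.2 z q hq
    _ ≤ _ := cycleWeight_le_scaledCost hμ q
    _ ≤ scaleUnit n α (ι / levelCount n k) * X := by
        gcongr
        exact hX

/-- With high probability, some estimate is good. -/
theorem pi_not_exists_cycleEstimate_le_mul (hn : 3 ≤ n) (hk : 1 ≤ k) (hα : 0 < α)
    (hN : N.PolyBounded A a) {v₀ : Fin n} {c : N.graph.Walk v₀ v₀} (hc : c.IsCycle)
    (hlen : (c.length : ℝ) ≤ hopBound n α) :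
    MeasureTheory.Measure.pi (fun _ : Fin n => uniformLaw)
      {ω | ¬ ∃ v, (N.cycleEstimate (cyclePlan A a k n α) ω v : ℝ) ≤ (k + 1) * N.cycleWeight c} ≤
    ENNReal.ofReal (2 / n + 1 / log n) := by
  have hL := one_le_log_of_three_le hn
  have hn0 : (0 : ℝ) < n := by positivity
  have hK := levelCount_pos hn hk
  have hw := one_le_cycleWeight hc
  -- The right scale has w ≤ 2^s ≤ 2w: rounding up adds at most ε 2^s ≤ 2εw over the whole cycle.
  set s := Nat.clog 2 (N.cycleWeight c) with hs
  have hs1 : (N.cycleWeight c : ℝ) ≤ 2 ^ s := by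
    exact_mod_cast Nat.le_pow_clog (by simp) (N.cycleWeight c)
  have hs2 : (2 : ℝ) ^ s ≤ 2 * N.cycleWeight c := by
    rcases hw.eq_or_lt with h | h
    · rw [hs, ← h]
      simp
    · have hpos : 0 < s := Nat.clog_pos (by simp) h
      obtain ⟨e, he⟩ := Nat.exists_eq_add_of_le' hpos
      have h2 := Nat.pow_pred_clog_lt_self (b := 2) (by simp) h
      rw [← hs] at h2
      rw [he] at h2 ⊢
      rw [pow_succ]
      have h3 : (2 : ℝ) ^ e ≤ N.cycleWeight c := by exact_mod_cast h2.le
      linarith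
  have hμ := scaleUnit_pos hn hα s
  set μ := scaleUnit n α s with hμdef
  set ε := roundingError n with hε
  have hε0 : 0 < ε := by rw [hε, roundingError]; positivity
  have hε1 : ε ≤ 1 := by
    rw [hε, roundingError, div_le_one (by positivity)]
    have := one_le_pow₀ hL (n := 2)
    linarith
  have hhop : 0 < hopBound n α := by rw [hopBound]; positivity
  have hμhop : μ * hopBound n α = ε * 2 ^ s := by
    rw [hμdef, scaleUnit, ← hε]
    field_simp
  have hcost := scaledCost_le (N := N) hμ c
  have hcost' : μ * N.scaledCost (fun ω => ⌈ω / μ⌉₊) c ≤ N.cycleWeight c + ε * 2 ^ s := by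
    rw [← hμhop]
    refine hcost.trans ?_
    gcongr
  have hdiv : ∀ i < levelCount n k, (s * levelCount n k + i) / levelCount n k = s := fun i hi => by
    rw [mul_comm, Nat.mul_add_div hK, Nat.div_eq_of_lt hi, add_zero]
  have hmod : ∀ i < levelCount n k, (s * levelCount n k + i) % levelCount n k = i := fun i hi => by
    rw [mul_comm, Nat.mul_add_mod, Nat.mod_eq_of_lt hi]
  have hmain := pi_not_exists_cycleEstimate_le (N := N) (P := cyclePlan A a k n α)
    (levelProb_pos (k := k) hn).le (levelProb_le_one hn) (s := s) (K := levelCount n k)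
    (t := listSize n k) (scale := fun ω => ⌈ω / μ⌉₊) (value := fun X => ⌊μ * X⌋₊)
    (fun ω hω => Nat.ceil_pos.mpr (by
      have : (0 : ℝ) < ω := by exact_mod_cast hω
      positivity))
    (fun i hi => by
      have h1 : s ≤ Nat.clog 2 (cycleCap A a n) := Nat.clog_mono_right 2 (cycleWeight_le_cap hN hc)
      have h2 := Nat.mul_le_mul_right (levelCount n k) (Nat.succ_le_succ h1)
      rw [Nat.succ_mul s] at h2
      exact lt_of_lt_of_le (by omega) h2)
    (fun i hi => by simp only [cyclePlan, hdiv i hi, hμdef])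
    (fun i hi => by simp only [cyclePlan, hdiv i hi, hμdef])
    (fun i hi => by simp only [cyclePlan, hmod i hi]) hc (by
      have h1 : (N.scaledCost (fun ω => ⌈ω / μ⌉₊) c : ℝ) ≤ 2 * (hopBound n α / ε) := by
        refine le_of_mul_le_mul_left (hcost'.trans ?_) hμ
        have h2 : μ * (2 * (hopBound n α / ε)) = 2 * 2 ^ s := by
          calc _ = 2 * (μ * hopBound n α) / ε := by ring
            _ = _ := by rw [hμhop]; field_simp
        rw [h2]
        have h3 : ε * 2 ^ s ≤ 2 ^ s := mul_le_of_le_one_left (by positivity) hε1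
        linarith
      have h2 : ((levelCount n k * N.scaledCost (fun ω => ⌈ω / μ⌉₊) c : ℕ) : ℝ) ≤
          (2 * ⌈levelCount n k * hopBound n α / ε⌉₊ : ℕ) := by
        push_cast
        calc _ ≤ (levelCount n k : ℝ) * (2 * (hopBound n α / ε)) := by gcongr
          _ = 2 * (levelCount n k * hopBound n α / ε) := by ring
          _ ≤ _ := by
            gcongr
            exact Nat.le_ceil _
      have h3 : (levelCount n k * N.scaledCost (fun ω => ⌈ω / μ⌉₊) c) ≤
          2 * ⌈levelCount n k * hopBound n α / ε⌉₊ := by exact_mod_cast h2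
      change _ ≤ 2 * (⌈levelCount n k * hopBound n α / ε⌉₊ + listSize n k)
      omega)
  refine (MeasureTheory.measure_mono ?_).trans
    (hmain.trans (ENNReal.ofReal_le_ofReal (failure_probability_le hn hk)))
  intro ω hω h
  refine hω ?_
  obtain ⟨v, X, hX, hv⟩ := h
  refine ⟨v, ?_⟩
  have hX' : (X : ℝ) ≤ levelCount n k * N.scaledCost (fun ω => ⌈ω / μ⌉₊) c := by exact_mod_cast hX
  calc (N.cycleEstimate (cyclePlan A a k n α) ω v : ℝ) ≤ ⌊μ * X⌋₊ := by exact_mod_cast hv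
    _ ≤ μ * X := Nat.floor_le (by positivity)
    _ ≤ μ * (levelCount n k * N.scaledCost (fun ω => ⌈ω / μ⌉₊) c) := by gcongr
    _ = levelCount n k * (μ * N.scaledCost (fun ω => ⌈ω / μ⌉₊) c) := by ring
    _ ≤ levelCount n k * (N.cycleWeight c + ε * (2 * N.cycleWeight c)) := by
        gcongr
        refine hcost'.trans ?_
        gcongr
    _ = levelCount n k * (1 + 2 * ε) * N.cycleWeight c := by ring
    _ ≤ (k + 1) * N.cycleWeight c := by
        gcongr
        exact levelCount_mul_le hn hk

end Network

theorem mainTheorem5 (A a : ℕ) :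
    ∃ (B c : ℕ) (C : ℝ) (δ : ℕ → ENNReal), Filter.Tendsto δ Filter.atTop (nhds 0) ∧
      ∀ k : ℝ, 1 ≤ k →
        ∃ P : (n : ℕ) → (α : ℝ) → CongestAlgorithm (B * Nat.clog 2 n),
          ∀ (n : ℕ) (α : ℝ) (N : Network n),
            N.PolyBounded A a → 1 ≤ α → α ≤ n / Real.log n →
            ∀ (v₀ : Fin n) (K : N.graph.Walk v₀ v₀), N.IsMinWeightCycle K →
              (K.length : ℝ) ≤ 10 * n * Real.log n / α →
              ∃ R : ℕ,
                (R : ℝ) ≤ C * Real.log n ^ c *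
                  ((n : ℝ) ^ (1 / k) + n / α + N.graph.diam) ∧
                (P n α).HaltsWithin N R ∧
                (P n α).law n {ω | ¬ ∃ x : ℝ, (P n α).Outputs N ω R x ∧
                  (N.cycleWeight K : ℝ) ≤ x ∧ x ≤ (k + 1) * N.cycleWeight K} ≤ δ n := by
  refine ⟨22 + 2 * (A + a), 6, 320 * (A + 3 * a + 4) + 24, _, tendsto_failure_probability,
    fun k hk => ⟨fun n α => (cyclePlan A a k n α).algorithm uniformLaw _,
      fun n α N hN hα _ v₀ K hK hlen => ?_⟩⟩
  -- A cycle forces three nodes, hence log n ≥ 1, on which all estimates rest.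
  have hn : 3 ≤ n := hK.1.three_le_length.trans (Network.length_le_card hK.1)
  have hα0 : 0 < α := by linarith
  have hout := fun ω => Network.outputs_algorithm (N := N) (P := cyclePlan A a k n α)
    (law := uniformLaw) (b := (22 + 2 * (A + a)) * Nat.clog 2 n) (Network.one_le_scale hn hα0)
    (fun v => Nat.lt_succ_of_le (hN.2 v)) (fun d hd v => pair_lt_two_pow A a hn hk hα hd (hN.2 v))
    (cap_mul_modulus_le A a hn) (Nat.mul_pos (by omega) (Nat.clog_pos (by simp) (by omega))) ω
  refine ⟨_, rounds_le A a N.graph.diam hn hk hα0, fun ω v => ?_, ?_⟩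
  · obtain ⟨u, hu, -⟩ := hout ω
    rw [hu v]
    rfl
  · refine (MeasureTheory.measure_mono ?_).trans
      (Network.pi_not_exists_cycleEstimate_le_mul (A := A) (a := a) hn hk hα0 hN hK.1 hlen)
    intro ω hω h
    refine hω ?_
    -- The common output is the minimum of the estimates, so a single good estimate suffices.
    obtain ⟨v, hv⟩ := h
    obtain ⟨u, hu, hmin⟩ := hout ω
    exact ⟨_, hu, by exact_mod_cast Network.cycleWeight_le_cycleEstimate hn hα0 hN hK ω u,
      le_trans (by exact_mod_cast hmin v) hv⟩
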